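/- **Setting.** A labelled event structure $\mathfrak E=(E,\preccurlyeq,\sharp,\eta)$ consists of a set $E$ of events, a partial order $\preccurlyeq$ on $E$ such that $\{e' : e'\preccurlyeq e\}$ is finite for every $e$, an irreflexive symmetric conflict relation $\sharp$ with $e_1\sharp e_2\preccurlyeq e_3\Rightarrow e_1\sharp e_3$, and a labelling $\eta:E\to\Sigma$, where $\Sigma=\mathbb N$. Events $e_1,e_2$ are concurrent, $e_1\mathrel{co}e_2$, if $e_1\not\preccurlyeq e_2$, $e_2\not\preccurlyeq e_1$ and not $e_1\sharp e_2$. *Configurations* are the finite, conflict-free, $\preccurlyeq$-downward closed sets of events; $C\xrightarrow{e}C'$ means $e\notin C$ and $C'=C\cup\{e\}$ for configurations $C,C'$. The *future* of $C$ is the labelled event structure induced on the events that are not in $C$ and not in conflict with any event of $C$. $\mathfrak E$ is *regular* if at every configuration only finitely many events can occur, and the relation "the futures of $C$ and $C'$ are isomorphic as labelled event structures" has finitely many classes on the configurations of $\mathfrak E$. (Thiagarajan's regular trace event structures are regular in this sense; no further condition on the labelling is imposed.) The *system* of $\mathfrak E$ has the configurations as states, $s_0=\emptyset$ as initial state, the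 transitions $T=\{(C,\eta(e),C') : C\xrightarrow{e}C'\}$, and the independence relation $I$ of those pairs $((C_1,a,C_1'),(C_2,b,C_2'))$ of transitions for which there are $e_1\mathrel{co}e_2$ with $\eta(e_1)=a$, $\eta(e_2)=b$ and $C_i\xrightarrow{e_i}C_i'$. For $t=(s,a,s')$ put $\sigma(t)=s$, $\delta(t)=a$, $\tau(t)=s'$, and let $t\otimes t'$ iff $\sigma(t)=\sigma(t')$ and $t\,I\,t'$; $\ t\ominus t'$ iff $\tau(t)=\sigma(t')$ and $t\,I\,t'$; $\ t\le t'$ iff $\tau(t)=\sigma(t')$ and not $t\,I\,t'$. An additional empty transition $t_\epsilon$ satisfies $t_\epsilon\le t$ iff $\sigma(t)=s_0$, and never $t_\epsilon\ominus t$. The *maximal set* at $s$ is $\mathfrak X(s)=\{t\in T:\sigma(t)=s\}$. A set of transitions is *conflict-free* if any two different elements are in $\otimes$ (so they have the same source). A *support set* is a maximal set or a non-empty conflict-free set; $M\sqsubseteq R$ means that $M\subseteq R$ is a conflict-free support set such that no $t\in R\setminus M$ satisfies $t\otimes t'$ for all $t'\in M$. Let $\mathcal X$ consist of the maximal sets $\mathfrak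 X(s)$ and of the sets $M\sqsubseteq\mathfrak X(s)$ for states $s$. A *process* is an element of $\mathfrak S=\mathcal X\times(T\cup\{t_\epsilon\})$; the initial process is $H_0=(\mathfrak X(s_0),t_\epsilon)$. *Trace Fixpoint Logic* (TFL) has the formulae $\phi::=Z\mid\neg\phi\mid\phi\wedge\phi\mid\langle a\rangle_c\phi\mid\langle a\rangle_{nc}\phi\mid\langle\otimes\rangle\phi\mid\mu Z.\phi$ with $a\in\Sigma$ and $Z$ in a countable set of variables, where in $\mu Z.\phi$ every free occurrence of $Z$ in $\phi$ is under an even number of negations. For a valuation $\mathcal V$ of the variables by subsets of $\mathfrak S$, the denotation $[\![\phi]\!]_{\mathcal V}\subseteq\mathfrak S$ is $\mathcal V(Z)$ for a variable $Z$, complement and intersection for $\neg$ and $\wedge$, and - $[\![\langle a\rangle_c\phi]\!]_{\mathcal V}=\{(R,t): \exists r\in R.\ \delta(r)=a,\ t\le r,\ (\mathfrak X(\tau(r)),r)\in[\![\phi]\!]_{\mathcal V}\}$, - $[\![\langle a\rangle_{nc}\phi]\!]_{\mathcal V}$: the same with $t\ominus r$ in place of $t\le r$, - $[\![\langle\otimes\rangle\phi]\!]_{\mathcal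 V}=\{(R,t):\exists M\in\mathcal X.\ M\sqsubseteq R,\ (M,t)\in[\![\phi]\!]_{\mathcal V}\}$, - $[\![\mu Z.\phi]\!]_{\mathcal V}=\bigcap\{Q\subseteq\mathfrak S:[\![\phi]\!]_{\mathcal V[Z:=Q]}\subseteq Q\}$. A *TFL specification* is a formula without free variables. $\mathfrak E$ satisfies a specification $\phi$ if $H_0\in[\![\phi]\!]_{\mathcal V}$ for the system of $\mathfrak E$; this does not depend on $\mathcal V$. A *regular quotient set* of $\mathfrak E$ is given by an equivalence relation $\sim$ on the configurations with finitely many classes such that $C\sim C'$ implies that the futures of $C$ and $C'$ are isomorphic. A *presentation* of $\mathfrak E$ and $\sim$ consists of three programs (codes of partial recursive functions) which, for some injective numbering of the events by natural numbers, compute the label of an event, compute from a configuration $C$ the finite set of all $e$ with $C\xrightarrow{e}C'$ for some $C'$, and decide $C\sim C'$ for configurations $C,C'$. Finite sets of events are given by their canonical indices $\sum_{e}2^{\mathrm{num}(e)}$; nothing is required of the programs on other inputs. **Theorem.** Model-checking regular (in particular, regular trace) event structures against TFL specifications is decidable: 1. There is a single algorithm (a partial recursive function) which, given the three programs of any presentation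 of an event structure $\mathfrak E$ represented as a regular quotient set, and given a TFL specification $\phi$, terminates and answers correctly whether $\mathfrak E$ satisfies $\phi$. (The number of classes of $\sim$ is not part of the input.) 2. For every regular event structure $\mathfrak E$, with or without such a presentation, the set of TFL specifications that $\mathfrak E$ satisfies is decidable: there is a computable $d:\mathbb N\to\{\text{true},\text{false}\}$ such that, for every specification $\phi$, $d$ returns true on the code of $\phi$ iff $\mathfrak E$ satisfies $\phi$. -/

import Mathlib

open Nat.Partrec (Code)

universe u v w

/-! ## Labelled event structures -/

/-- A labelled (prime) event structure with events `α` and labels `Λ`. -/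
structure EventStructure (α : Type u) (Λ : Type v) where
  le : α → α → Prop
  conflict : α → α → Prop
  label : α → Λ
  le_refl : ∀ e, le e e
  le_trans : ∀ e₁ e₂ e₃, le e₁ e₂ → le e₂ e₃ → le e₁ e₃
  le_antisymm : ∀ e₁ e₂, le e₁ e₂ → le e₂ e₁ → e₁ = e₂
  conflict_irrefl : ∀ e, ¬ conflict e e
  conflict_symm : ∀ e₁ e₂, conflict e₁ e₂ → conflict e₂ e₁
  conflict_inherit : ∀ e₁ e₂ e₃, conflict e₁ e₂ → le e₂ e₃ → conflict e₁ e₃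
  finite_causes : ∀ e, {e' | le e' e}.Finite

/-! ## Systems, i.e. rooted transition systems with an independence relation -/

/-- The data `(S, s₀, T, I, Σ)` of a transition system with independence. -/
structure System (Λ : Type v) where
  State : Type u
  init : State
  trans : Set (State × Λ × State)
  indep : trans → trans → Prop

namespace EventStructure

variable {α : Type u} {Λ : Type v} (E : EventStructure α Λ)

/-- Two events are concurrent. -/
def co (e₁ e₂ : α) : Prop := ¬ E.le e₁ e₂ ∧ ¬ E.le e₂ e₁ ∧ ¬ E.conflict e₁ e₂

/-- The finite configurations, that is, the configurations reachable from `∅` by adding one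
event at a time. -/
structure Config where
  events : Finset α
  conflict_free : ∀ e₁ ∈ events, ∀ e₂ ∈ events, ¬ E.conflict e₁ e₂
  down_closed : ∀ e ∈ events, ∀ e', E.le e' e → e' ∈ events

/-- The initial configuration. -/
def Config.empty : E.Config where
  events := ∅
  conflict_free := by simp
  down_closed := by simp

variable {E}

/-- `C —e→ C'`: the configuration `C'` is `C ∪ {e}`, with `e ∉ C`. -/
def Step (C : E.Config) (e : α) (C' : E.Config) : Prop :=
  e ∉ C.events ∧ ∀ x, x ∈ C'.events ↔ x ∈ C.events ∨ x = e

/-- The event `e` can occur at `C`. -/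
def Enabled (C : E.Config) (e : α) : Prop := ∃ C', Step C e C'

/-- The future of `C`: the events that are not in `C` and not in conflict with `C`. -/
def future (C : E.Config) : Set α :=
  {e | e ∉ C.events ∧ ∀ e' ∈ C.events, ¬ E.conflict e' e}

/-- The futures of `C` and `C'` are isomorphic labelled event structures. -/
def FutureIso (C C' : E.Config) : Prop :=
  ∃ f : future C ≃ future C',
    (∀ x y, E.le (f x : α) (f y) ↔ E.le (x : α) y) ∧
    (∀ x y, E.conflict (f x : α) (f y) ↔ E.conflict (x : α) y) ∧
    (∀ x, E.label (f x : α) = E.label (x : α))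

variable (E)

/-- Isomorphism of futures, as an equivalence relation on configurations. -/
def futureSetoid : Setoid E.Config where
  r := FutureIso
  iseqv :=
    { refl := fun _ => ⟨Equiv.refl _, fun _ _ => Iff.rfl, fun _ _ => Iff.rfl, fun _ => rfl⟩
      symm := by
        rintro C C' ⟨f, h₁, h₂, h₃⟩
        exact ⟨f.symm, fun x y => by simpa using (h₁ (f.symm x) (f.symm y)).symm,
          fun x y => by simpa using (h₂ (f.symm x) (f.symm y)).symm,
          fun x => by simpa using (h₃ (f.symm x)).symm⟩
      trans := by
        rintro C₁ C₂ C₃ ⟨f, h₁, h₂, h₃⟩ ⟨g, k₁, k₂, k₃⟩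
        exact ⟨f.trans g, fun x y => (k₁ (f x) (f y)).trans (h₁ x y),
          fun x y => (k₂ (f x) (f y)).trans (h₂ x y),
          fun x => (k₃ (f x)).trans (h₃ x)⟩ }

/-- Finite branching. -/
def ImageFinite : Prop := ∀ C : E.Config, {e | Enabled C e}.Finite

/-- Regular event structures: finitely branching, and only finitely many futures of
configurations up to isomorphism. -/
structure IsRegular : Prop where
  imageFinite : E.ImageFinite
  finiteIndex : Finite (Quotient E.futureSetoid)

/-- The system determined by an event structure. -/
def toSystem : System.{u, v} Λ where
  State := E.Config
  init := Config.empty E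
  trans := {t | ∃ e, t.2.1 = E.label e ∧ Step t.1 e t.2.2}
  indep := fun t₁ t₂ => ∃ e₁ e₂, E.co e₁ e₂ ∧
    t₁.1.2.1 = E.label e₁ ∧ t₂.1.2.1 = E.label e₂ ∧
    Step t₁.1.1 e₁ t₁.1.2.2 ∧ Step t₂.1.1 e₂ t₂.1.2.2

end EventStructure

/-! ## Trace Fixpoint Logic -/

/-- Formulae: variables, negation, conjunction, the causal and the non-causal diamond, the
diamond over maximal traces, and least fixpoints. Variables are natural numbers. -/
inductive TFL (Λ : Type v) : Type v
  | var (z : ℕ)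
  | neg (φ : TFL Λ)
  | and (φ ψ : TFL Λ)
  | diaC (a : Λ) (φ : TFL Λ)
  | diaNC (a : Λ) (φ : TFL Λ)
  | diaTrace (φ : TFL Λ)
  | mu (z : ℕ) (φ : TFL Λ)

namespace TFL

variable {Λ : Type v}

/-- `φ.Parity true z`: every free occurrence of `z` in `φ` is in the scope of an even number of
negations; `φ.Parity false z`: of an odd number. -/
def Parity : TFL Λ → Bool → ℕ → Prop
  | var y, b, z => y = z → b = true
  | neg φ, b, z => φ.Parity (!b) z
  | and φ ψ, b, z => φ.Parity b z ∧ ψ.Parity b z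
  | diaC _ φ, b, z => φ.Parity b z
  | diaNC _ φ, b, z => φ.Parity b z
  | diaTrace φ, b, z => φ.Parity b z
  | mu y φ, b, z => y ≠ z → φ.Parity b z

/-- In every subformula `μ z. ψ`, the free occurrences of `z` in `ψ` are under an even number of
negations. -/
def WellFormed : TFL Λ → Prop
  | var _ => True
  | neg φ => φ.WellFormed
  | and φ ψ => φ.WellFormed ∧ ψ.WellFormed
  | diaC _ φ => φ.WellFormed
  | diaNC _ φ => φ.WellFormed
  | diaTrace φ => φ.WellFormed
  | mu z φ => φ.Parity true z ∧ φ.WellFormed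

/-- The free variables of a formula. -/
def freeVars : TFL Λ → Set ℕ
  | var z => {z}
  | neg φ => φ.freeVars
  | and φ ψ => φ.freeVars ∪ ψ.freeVars
  | diaC _ φ => φ.freeVars
  | diaNC _ φ => φ.freeVars
  | diaTrace φ => φ.freeVars
  | mu z φ => φ.freeVars \ {z}

/-- Specifications: the formulae of the logic without free variables. -/
def IsSpec (φ : TFL Λ) : Prop := φ.WellFormed ∧ φ.freeVars = ∅

/-- Gödel numbers of the formulae over the labels `0, 1, 2, …`. -/
def code : TFL ℕ → ℕ
  | var z => 7 * z
  | neg φ => 7 * φ.code + 1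
  | and φ ψ => 7 * Nat.pair φ.code ψ.code + 2
  | diaC a φ => 7 * Nat.pair a φ.code + 3
  | diaNC a φ => 7 * Nat.pair a φ.code + 4
  | diaTrace φ => 7 * φ.code + 5
  | mu z φ => 7 * Nat.pair z φ.code + 6

theorem code_injective : Function.Injective code := by
  intro φ
  induction φ with
  | var z => intro ψ h; cases ψ <;> simp only [code] at h <;> first | omega | skip
             congr 1; omega
  | neg φ ih => intro ψ h; cases ψ <;> simp only [code] at h <;> first | omega | skip
                congr 1; exact ih (by omega)
  | and φ₁ φ₂ ih₁ ih₂ =>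
    intro ψ h; cases ψ <;> simp only [code] at h <;> first | omega | skip
    obtain ⟨h₁, h₂⟩ := Nat.pair_eq_pair.1
      (Nat.eq_of_mul_eq_mul_left (by norm_num) (Nat.add_right_cancel h))
    rw [ih₁ h₁, ih₂ h₂]
  | diaC a φ ih =>
    intro ψ h; cases ψ <;> simp only [code] at h <;> first | omega | skip
    obtain ⟨h₁, h₂⟩ := Nat.pair_eq_pair.1
      (Nat.eq_of_mul_eq_mul_left (by norm_num) (Nat.add_right_cancel h))
    rw [h₁, ih h₂]
  | diaNC a φ ih =>
    intro ψ h; cases ψ <;> simp only [code] at h <;> first | omega | skip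
    obtain ⟨h₁, h₂⟩ := Nat.pair_eq_pair.1
      (Nat.eq_of_mul_eq_mul_left (by norm_num) (Nat.add_right_cancel h))
    rw [h₁, ih h₂]
  | diaTrace φ ih => intro ψ h; cases ψ <;> simp only [code] at h <;> first | omega | skip
                     congr 1; exact ih (by omega)
  | mu z φ ih =>
    intro ψ h; cases ψ <;> simp only [code] at h <;> first | omega | skip
    obtain ⟨h₁, h₂⟩ := Nat.pair_eq_pair.1
      (Nat.eq_of_mul_eq_mul_left (by norm_num) (Nat.add_right_cancel h))
    rw [h₁, ih h₂]

end TFL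

namespace System

variable {Λ : Type v} (T : System.{u, v} Λ)

/-- The transitions of a system. -/
abbrev Tr : Type (max u v) := T.trans

variable {T}

/-- The source of a transition. -/
def src (t : T.Tr) : T.State := t.1.1

/-- The label of a transition. -/
def lbl (t : T.Tr) : Λ := t.1.2.1

/-- The target of a transition. -/
def tgt (t : T.Tr) : T.State := t.1.2.2

/-- `t ⊗ t'`: immediate concurrency. -/
def ImmConc (t t' : T.Tr) : Prop := src t = src t' ∧ T.indep t t'

/-- `t ≤ t'`: causal dependence of `t'` on `t`; here `none` is the empty transition, on which
all transitions from the initial state depend. -/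
def CausDep : Option T.Tr → T.Tr → Prop
  | none, r => src r = T.init
  | some t, r => tgt t = src r ∧ ¬ T.indep t r

/-- `t ⊖ t'`: linearised concurrency. -/
def LinConc : Option T.Tr → T.Tr → Prop
  | none, _ => False
  | some t, r => tgt t = src r ∧ T.indep t r

variable (T)

/-- The maximal set of transitions at a state. -/
def maxSet (s : T.State) : Set T.Tr := {t | src t = s}

variable {T}

/-- Any two different elements of `P` are immediately concurrent (in particular they have the
same source). -/
def ConflictFree (P : Set T.Tr) : Prop := ∀ t ∈ P, ∀ t' ∈ P, t ≠ t' → ImmConc t t'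

/-- Support sets: maximal sets, and non-empty conflict-free sets. -/
def IsSupport (R : Set T.Tr) : Prop :=
  (∃ s, R = T.maxSet s) ∨ (R.Nonempty ∧ ConflictFree R)

/-- `M ⊑ R`: `M` is a complete trace of `R`. -/
def CompleteTrace (M R : Set T.Tr) : Prop :=
  IsSupport M ∧ ConflictFree M ∧ M ⊆ R ∧ ¬ ∃ t ∈ R \ M, ∀ t' ∈ M, ImmConc t t'

variable (T)

/-- The maximal sets and the maximal traces. -/
def maximalSets : Set (Set T.Tr) :=
  {R | ∃ s, R = T.maxSet s ∨ CompleteTrace R (T.maxSet s)}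

/-- The stateless maximal process space. -/
abbrev Proc : Type (max u v) := T.maximalSets × Option T.Tr

/-- The process with the maximal set at `s` as its support set. -/
def maxProc (s : T.State) (t : Option T.Tr) : T.Proc :=
  (⟨T.maxSet s, s, Or.inl rfl⟩, t)

/-- The initial process. -/
def initProc : T.Proc := T.maxProc T.init none

/-- The denotation of a formula under a valuation. -/
def denote : TFL Λ → (ℕ → Set T.Proc) → Set T.Proc
  | .var z, V => V z
  | .neg φ, V => (denote φ V)ᶜ
  | .and φ ψ, V => denote φ V ∩ denote ψ V
  | .diaC a φ, V => {p | ∃ r ∈ p.1.1, lbl r = a ∧ CausDep p.2 r ∧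
      T.maxProc (tgt r) (some r) ∈ denote φ V}
  | .diaNC a φ, V => {p | ∃ r ∈ p.1.1, lbl r = a ∧ LinConc p.2 r ∧
      T.maxProc (tgt r) (some r) ∈ denote φ V}
  | .diaTrace φ, V => {p | ∃ M : T.maximalSets, CompleteTrace M.1 p.1.1 ∧ (M, p.2) ∈ denote φ V}
  | .mu z φ, V => ⋂₀ {Q | denote φ (Function.update V z Q) ⊆ Q}

end System

/-! ## Regular quotient sets and their finite presentations -/

namespace EventStructure

variable {α : Type u}

/-- The equivalence relation `sim` has finitely many classes, and equivalent configurations have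
isomorphic futures. -/
structure IsRegularQuotient {Λ : Type v} (E : EventStructure α Λ) (sim : Setoid E.Config) :
    Prop where
  finiteIndex : Finite (Quotient sim)
  futureIso : ∀ C C' : E.Config, sim C C' → FutureIso C C'

/-- The canonical index of a finite set of events that are numbered by `num`. -/
def canonicalIndex (num : α → ℕ) (F : Finset α) : ℕ := ∑ e ∈ F, 2 ^ num e

/-- The event structure `E`, with its events numbered by `num`, and the quotient of its
configurations by `sim` are presented by three programs: `lab` computes labels of events, `next`
computes the set of the events that can occur at a given configuration, and `eqv` decides `sim`.
(Configurations and finite sets of events are given to programs by their canonical indices. No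
requirement is made on inputs that are not numbers of events or indices of configurations.) -/
structure IsPresentedBy (E : EventStructure α ℕ) (sim : Setoid E.Config) (num : α → ℕ)
    (lab next eqv : Code) : Prop where
  num_injective : Function.Injective num
  lab_spec : ∀ e, lab.eval (num e) = Part.some (E.label e)
  next_spec : ∀ C : E.Config, ∃ F : Finset α, (∀ e, e ∈ F ↔ Enabled C e) ∧
    next.eval (canonicalIndex num C.events) = Part.some (canonicalIndex num F)
  eqv_true : ∀ C C' : E.Config, sim C C' →
    eqv.eval (Nat.pair (canonicalIndex num C.events) (canonicalIndex num C'.events)) = Part.some 1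
  eqv_false : ∀ C C' : E.Config, ¬ sim C C' →
    eqv.eval (Nat.pair (canonicalIndex num C.events) (canonicalIndex num C'.events)) = Part.some 0

end EventStructure

/-!
Each of the three diamonds of the logic is an ordinary modality for a suitable relation between
processes, so formulae are invariant under bisimulations that are partial functions
(`TFL.mem_den_iff_of_bisim`). It therefore suffices to replace the infinite system of processes by
a finite one, on which least fixpoints are computed by iteration.

A process is described by events alone: the current configuration, the set of the events that could
occur before the last transition, and the events of the support set (`EventStructure.Position`).
After `d` has occurred at `C`, an enabled event is concurrent with `d` iff it was already enabled
at `C`, and two events enabled at `C` are concurrent iff one remains enabled after the other. So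
all relations between positions can be computed from the function that maps a configuration to the
events that can occur at it. An isomorphism between the futures of `C` and `D` turns the processes
that start with an event at `C` into bisimilar processes at `D`
(`EventStructure.Position.Matches`).

The isomorphisms themselves are not available to an algorithm, and the number of classes is not
known. Instead, bisimilarity is approximated from above: `LTS.typ R n` is a number that codes the
behaviour up to depth `n`. An exploration to depth `j` is conclusive as soon as the configurations
at distance `j + 1` are equivalent to configurations at distance at most `j`, and types of depth
`j` determine the types of depth `j + 1` on the positions at distance at most `j + 2`. For these
positions represent all positions up to bisimilarity
(`EventStructure.Position.covers_level`), hence types of depth `j` determine the bisimilarity class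
of every position, and they are the points of a finite quotient (`LTS.mem_den_iff_quotient`). By
regularity both conditions hold for some `j` (`EventStructure.Position.exists_exhaustive`).

For a single regular event structure the quotient is a constant, which gives decidability of its
theory (`EventStructure.IsRegular.exists_computable`). For presented event structures the algorithm
searches for a number of computation steps and a depth `j` for which all required runs of the
programs halt and both conditions hold (`Programs.Exhaustive`); these are primitive recursive
conditions. The model checker for finite systems recurses through formulae with varying
environments, and is obtained from Kleene's recursion theorem (`FinSys.exists_modelChecker`).
-/

/-! ### Trace Fixpoint Logic as a modal μ-calculus -/

namespace TFL

variable {X : Type u} {Y : Type v}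

/-- The semantics of formulae over a family of relations on `X`, one for each modality. The
modalities are numbered: `3 * a` stands for `⟨a⟩_c`, `3 * a + 1` for `⟨a⟩_nc` and `2` for `⟨⊗⟩`. -/
def den (R : ℕ → X → X → Prop) : TFL ℕ → (ℕ → Set X) → Set X
  | var z, V => V z
  | neg φ, V => (den R φ V)ᶜ
  | and φ ψ, V => den R φ V ∩ den R ψ V
  | diaC a φ, V => {x | ∃ y, R (3 * a) x y ∧ y ∈ den R φ V}
  | diaNC a φ, V => {x | ∃ y, R (3 * a + 1) x y ∧ y ∈ den R φ V}
  | diaTrace φ, V => {x | ∃ y, R 2 x y ∧ y ∈ den R φ V}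
  | mu z φ, V => ⋂₀ {Q | den R φ (Function.update V z Q) ⊆ Q}

/-- The denotation is monotone in a variable with positive occurrences only (`b = true`), and
antitone in one with negative occurrences only (`b = false`). -/
theorem den_subset_of_parity (R : ℕ → X → X → Prop) (φ : TFL ℕ) :
    ∀ (V W : ℕ → Set X) (b : Bool) (z : ℕ), φ.Parity b z → (∀ y, y ≠ z → V y = W y) →
      (b = true → V z ⊆ W z) → (b = false → W z ⊆ V z) → den R φ V ⊆ den R φ W := by
  induction φ with
  | var y =>
    intro V W b z hp hne ht hf
    by_cases h : y = z
    · subst h; exact ht (hp rfl)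
    · exact (hne y h).subset
  | neg φ ih =>
    intro V W b z hp hne ht hf
    refine Set.compl_subset_compl.2 (ih W V (!b) z hp (fun y hy => (hne y hy).symm) ?_ ?_)
    · intro h; exact hf (by simpa using h)
    · intro h; exact ht (by simpa using h)
  | and φ ψ ih₁ ih₂ =>
    intro V W b z hp hne ht hf
    exact Set.inter_subset_inter (ih₁ V W b z hp.1 hne ht hf) (ih₂ V W b z hp.2 hne ht hf)
  | diaC a φ ih | diaNC a φ ih | diaTrace φ ih =>
    rintro V W b z hp hne ht hf x ⟨y, hxy, hy⟩
    exact ⟨y, hxy, ih V W b z hp hne ht hf hy⟩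
  | mu y φ ih =>
    intro V W b z hp hne ht hf x hx Q hQ
    suffices h : den R φ (Function.update V y Q) ⊆ den R φ (Function.update W y Q) from
      hx Q fun _ hw => hQ (h hw)
    by_cases h : y = z
    · subst h
      have : Function.update V y Q = Function.update W y Q := by
        funext i
        by_cases hi : i = y
        · subst hi; simp
        · simp [hi, hne i hi]
      rw [this]
    · refine ih _ _ b z (hp h) ?_ ?_ ?_
      · intro i hi
        by_cases hiy : i = y
        · subst hiy; simp
        · simp [hiy, hne i hi]
      · simpa [Function.update_of_ne (Ne.symm h)] using ht
      · simpa [Function.update_of_ne (Ne.symm h)] using hf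

theorem den_update_mono (R : ℕ → X → X → Prop) {φ : TFL ℕ} {z : ℕ} (h : φ.Parity true z)
    (V : ℕ → Set X) : Monotone fun Q => den R φ (Function.update V z Q) := by
  intro P Q hPQ
  refine den_subset_of_parity R φ _ _ true z h ?_ ?_ ?_
  · intro y hy; simp [hy]
  · intro _; simpa using hPQ
  · simp

/-- Formulae are invariant under a bisimulation that is a partial function. Functionality makes
the least fixpoints correspond: a prefixed point on either side can be carried to the other side
without changing which related points it relates. -/
theorem mem_den_iff_of_bisim {R : ℕ → X → X → Prop} {S : ℕ → Y → Y → Prop} (B : X → Y → Prop)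
    (hfun : ∀ x y y', B x y → B x y' → y = y')
    (zig : ∀ l x x' y, B x y → R l x x' → ∃ y', S l y y' ∧ B x' y')
    (zag : ∀ l x y y', B x y → S l y y' → ∃ x', R l x x' ∧ B x' y') (φ : TFL ℕ) :
    φ.WellFormed → ∀ (V : ℕ → Set X) (W : ℕ → Set Y),
      (∀ z ∈ φ.freeVars, ∀ x y, B x y → (x ∈ V z ↔ y ∈ W z)) →
      ∀ x y, B x y → (x ∈ den R φ V ↔ y ∈ den S φ W) := by
  have dia : ∀ (l : ℕ) (P : Set X) (Q : Set Y), (∀ x y, B x y → (x ∈ P ↔ y ∈ Q)) →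
      ∀ x y, B x y → ((∃ x', R l x x' ∧ x' ∈ P) ↔ ∃ y', S l y y' ∧ y' ∈ Q) := by
    intro l P Q h x y hxy
    constructor
    · rintro ⟨x', hx, hP⟩
      obtain ⟨y', hy, hB⟩ := zig l x x' y hxy hx
      exact ⟨y', hy, (h x' y' hB).1 hP⟩
    · rintro ⟨y', hy, hQ⟩
      obtain ⟨x', hx, hB⟩ := zag l x y y' hxy hy
      exact ⟨x', hx, (h x' y' hB).2 hQ⟩
  induction φ with
  | var z => intro _ V W h; exact h z rfl
  | neg φ ih => intro hw V W h x y hxy; exact not_congr (ih hw V W h x y hxy)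
  | and φ ψ ih₁ ih₂ =>
    intro hw V W h x y hxy
    exact and_congr (ih₁ hw.1 V W (fun z hz => h z (Or.inl hz)) x y hxy)
      (ih₂ hw.2 V W (fun z hz => h z (Or.inr hz)) x y hxy)
  | diaC a φ ih | diaNC a φ ih | diaTrace φ ih =>
    intro hw V W h
    exact dia _ _ _ (ih hw V W h)
  | mu z φ ih =>
    intro hw V W h x₀ y₀ hxy₀
    have key : ∀ (P : Set X) (Q : Set Y), (∀ x y, B x y → (x ∈ P ↔ y ∈ Q)) → ∀ x y, B x y →
        (x ∈ den R φ (Function.update V z P) ↔ y ∈ den S φ (Function.update W z Q)) := by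
      intro P Q hPQ
      refine ih hw.2 _ _ fun i hi x y hxy => ?_
      by_cases hiz : i = z
      · subst hiz; simpa using hPQ x y hxy
      · simpa [hiz] using h i ⟨hi, hiz⟩ x y hxy
    constructor
    · intro hx Q hQ
      -- pull `Q` back to all points whose image, if there is one, lies in `Q`
      have hP := key {x | ∀ y, B x y → y ∈ Q} Q fun x y hxy =>
        ⟨fun hx => hx y hxy, fun hy y' hy' => hfun x y y' hxy hy' ▸ hy⟩
      exact hx {x | ∀ y, B x y → y ∈ Q} (fun x hx y hxy => hQ ((hP x y hxy).1 hx)) y₀ hxy₀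
    · intro hy P hP
      -- push `P` forward to the points all of whose preimages lie in `P`
      have hQ := key {x | ∃ y, B x y ∧ ∀ x', B x' y → x' ∈ P} {y | ∀ x', B x' y → x' ∈ P}
        fun x y hxy => ⟨fun ⟨y', hy', h'⟩ => hfun x y y' hxy hy' ▸ h', fun h' => ⟨y, hxy, h'⟩⟩
      refine hy {y | ∀ x', B x' y → x' ∈ P} (fun y hy x hxy => hP ?_) x₀ hxy₀
      have hsub : {x | ∃ y, B x y ∧ ∀ x', B x' y → x' ∈ P} ⊆ P := fun x ⟨y, hB, h'⟩ => h' x hB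
      exact den_update_mono R hw.1 V hsub ((hQ x y hxy).2 hy)

end TFL

/-! ### Approximations of bisimilarity, and finite quotients -/

/-- The canonical index of a finite set of natural numbers. -/
def setCode (S : Finset ℕ) : ℕ := ∑ c ∈ S, 2 ^ c

theorem testBit_setCode (S : Finset ℕ) (c : ℕ) : (setCode S).testBit c = true ↔ c ∈ S := by
  rw [← Nat.mem_bitIndices, ← List.mem_toFinset, setCode, Finset.toFinset_bitIndices_sum_two_pow]

theorem setCode_injective : Function.Injective setCode := fun S T h =>
  Finset.ext fun c => by rw [← testBit_setCode, h, testBit_setCode]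

namespace LTS

variable {X : Type u} (R : ℕ → X → X → Prop)

open Classical in
/-- The `n`-th approximation of the bisimilarity class of a point, as a number: `typ R (n + 1) x`
is an index of the set of the pairs `(l, typ R n y)` with `R l x y`. (It is `0` when this set is
infinite.) -/
noncomputable def typ : ℕ → X → ℕ
  | 0, _ => 0
  | n + 1, x =>
    if h : {c | ∃ l y, R l x y ∧ c = Nat.pair l (typ n y)}.Finite then setCode h.toFinset else 0

/-- The points at distance at most `j` from `x₀`. -/
def level (x₀ : X) : ℕ → Set X
  | 0 => {x₀}
  | j + 1 => level x₀ j ∪ {y | ∃ x ∈ level x₀ j, ∃ l, R l x y}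

/-- The points that can be reached from `x₀`. -/
def Reach (x₀ : X) : Set X := {x | ∃ j, x ∈ level R x₀ j}

/-- From every point in `I` only finitely many transitions are possible. -/
def FinBranching (I : Set X) : Prop := ∀ x ∈ I, {p : ℕ × X | R p.1 x p.2}.Finite

variable {R} {x₀ : X}

theorem level_mono : Monotone (level R x₀) :=
  monotone_nat_of_le_succ fun _ => Set.subset_union_left

theorem level_subset_reach (j : ℕ) : level R x₀ j ⊆ Reach R x₀ := fun _ h => ⟨j, h⟩

theorem level_succ_of_rel {j l : ℕ} {x y : X} (hx : x ∈ level R x₀ j) (h : R l x y) :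
    y ∈ level R x₀ (j + 1) := Or.inr ⟨x, hx, l, h⟩

theorem reach_of_rel {l : ℕ} {x y : X} (hx : x ∈ Reach R x₀) (h : R l x y) : y ∈ Reach R x₀ := by
  obtain ⟨j, hj⟩ := hx
  exact ⟨j + 1, level_succ_of_rel hj h⟩

theorem reach_induction {P : X → Prop} (h₀ : P x₀) (h : ∀ l x y, P x → R l x y → P y) :
    ∀ x ∈ Reach R x₀, P x := by
  rintro x ⟨j, hj⟩
  induction j generalizing x with
  | zero => exact (Set.mem_singleton_iff.1 hj) ▸ h₀
  | succ j ih =>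
    rcases hj with hj | ⟨y, hy, l, hl⟩
    · exact ih x hj
    · exact h l y x (ih y hy) hl

theorem level_finite (hR : FinBranching R (Reach R x₀)) (j : ℕ) : (level R x₀ j).Finite := by
  induction j with
  | zero => exact Set.finite_singleton _
  | succ j ih =>
    refine ih.union ((ih.biUnion fun x hx =>
      ((hR x (level_subset_reach j hx)).image Prod.snd)).subset ?_)
    rintro y ⟨x, hx, l, hl⟩
    exact Set.mem_biUnion hx ⟨(l, y), hl, rfl⟩

theorem typ_finite {I : Set X} (hR : FinBranching R I) (n : ℕ) {x : X} (hx : x ∈ I) :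
    {c | ∃ l y, R l x y ∧ c = Nat.pair l (typ R n y)}.Finite := by
  refine ((hR x hx).image fun p => Nat.pair p.1 (typ R n p.2)).subset ?_
  rintro _ ⟨l, y, h, rfl⟩
  exact ⟨(l, y), h, rfl⟩

/-- Equality of types is the usual stratification of bisimilarity. -/
theorem typ_succ_eq_iff {I : Set X} (hR : FinBranching R I) (n : ℕ) {x y : X} (hx : x ∈ I)
    (hy : y ∈ I) : typ R (n + 1) x = typ R (n + 1) y ↔
      ∀ l t, (∃ x', R l x x' ∧ typ R n x' = t) ↔ ∃ y', R l y y' ∧ typ R n y' = t := by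
  have hmem : ∀ (x : X) l t, Nat.pair l t ∈ {c | ∃ l y, R l x y ∧ c = Nat.pair l (typ R n y)} ↔
      ∃ x', R l x x' ∧ typ R n x' = t := by
    intro x l t
    constructor
    · rintro ⟨l', x', h, h'⟩
      obtain ⟨rfl, rfl⟩ := Nat.pair_eq_pair.1 h'
      exact ⟨x', h, rfl⟩
    · rintro ⟨x', h, rfl⟩
      exact ⟨l, x', h, rfl⟩
  simp only [typ, dif_pos (typ_finite hR n hx), dif_pos (typ_finite hR n hy)]
  rw [setCode_injective.eq_iff, Set.Finite.toFinset_inj]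
  constructor
  · intro h l t
    rw [← hmem, ← hmem, h]
  · intro h
    ext c
    rw [← Nat.pair_unpair c, hmem, hmem, h]

theorem typ_eq_of_typ_succ_eq {I : Set X} (hR : FinBranching R I)
    (hI : ∀ l x y, x ∈ I → R l x y → y ∈ I) (n : ℕ) :
    ∀ x ∈ I, ∀ y ∈ I, typ R (n + 1) x = typ R (n + 1) y → typ R n x = typ R n y := by
  induction n with
  | zero => intros; rfl
  | succ n ih =>
    -- one inclusion of the sets of successors; the other one is symmetric
    have half : ∀ x ∈ I, ∀ y ∈ I, typ R (n + 2) x = typ R (n + 2) y → ∀ l t,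
        (∃ x', R l x x' ∧ typ R n x' = t) → ∃ y', R l y y' ∧ typ R n y' = t := by
      rintro x hx y hy h l _ ⟨x', hx', rfl⟩
      obtain ⟨y', hy', h'⟩ :=
        ((typ_succ_eq_iff hR (n + 1) hx hy).1 h l (typ R (n + 1) x')).1 ⟨x', hx', rfl⟩
      exact ⟨y', hy', ih _ (hI l y y' hy hy') _ (hI l x x' hx hx') h'⟩
    intro x hx y hy h
    rw [typ_succ_eq_iff hR n hx hy]
    exact fun l t => ⟨half x hx y hy h l t, half y hy x hx h.symm l t⟩

/-- Bisimilar points have the same type. -/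
theorem typ_eq_of_bisim {I : Set X} (hR : FinBranching R I)
    (hI : ∀ l x y, x ∈ I → R l x y → y ∈ I) (S : X → X → Prop)
    (zig : ∀ l x x' y, S x y → R l x x' → ∃ y', R l y y' ∧ S x' y')
    (zag : ∀ l x y y', S x y → R l y y' → ∃ x', R l x x' ∧ S x' y') (n : ℕ) :
    ∀ x ∈ I, ∀ y ∈ I, S x y → typ R n x = typ R n y := by
  induction n with
  | zero => intros; rfl
  | succ n ih =>
    intro x hx y hy hS
    rw [typ_succ_eq_iff hR n hx hy]
    intro l t
    constructor
    · rintro ⟨x', hx', rfl⟩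
      obtain ⟨y', hy', hS'⟩ := zig l x x' y hS hx'
      exact ⟨y', hy', (ih _ (hI l x x' hx hx') _ (hI l y y' hy hy') hS').symm⟩
    · rintro ⟨y', hy', rfl⟩
      obtain ⟨x', hx', hS'⟩ := zag l x y y' hS hy'
      exact ⟨x', hx', ih _ (hI l x x' hx hx') _ (hI l y y' hy hy') hS'⟩

/-- `L` contains, up to bisimilarity, all points that can be reached. -/
def Covers (R : ℕ → X → X → Prop) (x₀ : X) (L : Set X) : Prop :=
  L ⊆ Reach R x₀ ∧ ∀ x ∈ Reach R x₀, ∃ y ∈ L, ∀ n, typ R n x = typ R n y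

/-- Points of `L` that are identified by the `n`-th approximation are identified by the next one.
-/
def Stable (R : ℕ → X → X → Prop) (L : Set X) (n : ℕ) : Prop :=
  ∀ x ∈ L, ∀ y ∈ L, typ R n x = typ R n y → typ R (n + 1) x = typ R (n + 1) y

/-- On a finite set the approximations stabilise. -/
theorem eventually_stable (hR : FinBranching R (Reach R x₀)) {L : Set X} (hL : L ⊆ Reach R x₀)
    (hfin : L.Finite) : ∃ n₀, ∀ n, n₀ ≤ n → Stable R L n := by
  have := hfin.to_subtype
  let a : ℕ →o (Set (L × L)) :=
    ⟨fun n => {p | typ R n p.1 ≠ typ R n p.2}, monotone_nat_of_le_succ fun n p hp h =>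
      hp (typ_eq_of_typ_succ_eq hR (fun _ _ _ => reach_of_rel) n _ (hL p.1.2) _ (hL p.2.2) h)⟩
  obtain ⟨n₀, h₀⟩ := WellFoundedGT.monotone_chain_condition a
  refine ⟨n₀, fun n hn x hx y hy h => ?_⟩
  by_contra h'
  have h₁ : ((⟨x, hx⟩, ⟨y, hy⟩) : L × L) ∈ a (n + 1) := h'
  rw [← h₀ (n + 1) (by omega), h₀ n hn] at h₁
  exact h₁ h

theorem Stable.of_covers {L M : Set X} {n : ℕ} (hL : Covers R x₀ L) (h : Stable R L n)
    (hM : M ⊆ Reach R x₀) : Stable R M n := by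
  intro x hx y hy hxy
  obtain ⟨x', hx', h₁⟩ := hL.2 x (hM hx)
  obtain ⟨y', hy', h₂⟩ := hL.2 y (hM hy)
  rw [h₁, h₂]
  exact h x' hx' y' hy' (by rw [← h₁, ← h₂, hxy])

/-- If `n` is stable on a covering set `L`, then `typ R n` maps the reachable part onto a finite
system, whose transitions are those that start in `L`, and this map is a bisimulation. -/
theorem mem_den_iff_quotient (hR : FinBranching R (Reach R x₀)) {L : Set X} {n : ℕ}
    (hL : Covers R x₀ L) (hst : Stable R L n) {P : Set ℕ}
    (hP : ∀ k, k ∈ P ↔ k = typ R n x₀ ∨ ∃ x ∈ L, ∃ l y, R l x y ∧ k = typ R n y)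
    {S : ℕ → P → P → Prop}
    (hS : ∀ l k k', S l k k' ↔ ∃ x ∈ L, ∃ y, R l x y ∧ k.1 = typ R n x ∧ k'.1 = typ R n y)
    {φ : TFL ℕ} (hφ : φ.IsSpec) (V : ℕ → Set X) (W : ℕ → Set P) :
    x₀ ∈ TFL.den R φ V ↔ ⟨typ R n x₀, (hP _).2 (Or.inl rfl)⟩ ∈ TFL.den S φ W := by
  refine TFL.mem_den_iff_of_bisim (fun x k => x ∈ Reach R x₀ ∧ k.1 = typ R n x) ?_ ?_ ?_ φ hφ.1 V W
    (by simp [hφ.2]) _ _ ⟨⟨0, rfl⟩, rfl⟩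
  · rintro x y y' ⟨_, h⟩ ⟨_, h'⟩
    exact Subtype.ext (h.trans h'.symm)
  · rintro l x x' k ⟨hx, hk⟩ hl
    obtain ⟨y, hy, hxy⟩ := hL.2 x hx
    obtain ⟨y', hy', h'⟩ :=
      ((typ_succ_eq_iff hR n hx (hL.1 hy)).1 (hxy (n + 1)) l _).1 ⟨x', hl, rfl⟩
    refine ⟨⟨typ R n x', (hP _).2 (Or.inr ⟨y, hy, l, y', hy', h'.symm⟩)⟩, ?_,
      reach_of_rel hx hl, rfl⟩
    exact (hS _ _ _).2 ⟨y, hy, y', hy', hk.trans (hxy n), h'.symm⟩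
  · rintro l x k k' ⟨hx, hk⟩ hl
    obtain ⟨z, hz, z', hzz', h₁, h₂⟩ := (hS _ _ _).1 hl
    obtain ⟨y, hy, hxy⟩ := hL.2 x hx
    have h₃ : typ R (n + 1) x = typ R (n + 1) z := by
      rw [hxy]
      exact hst y hy z hz (by rw [← hxy, ← hk, h₁])
    obtain ⟨x', hx', h'⟩ := ((typ_succ_eq_iff hR n hx (hL.1 hz)).1 h₃ l _).2 ⟨z', hzz', rfl⟩
    exact ⟨x', hx', reach_of_rel hx hx', h₂.trans h'.symm⟩

end LTS

/-! ### Model checking finite systems -/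

section Primrec

variable {α β : Type*} [Primcodable α] [Primcodable β]

theorem PrimrecPred.exists_mem {f : α → List β} {p : α → β → Prop} (hf : Primrec f)
    (hp : PrimrecRel p) : PrimrecPred fun a => ∃ b ∈ f a, p a b :=
  (PrimrecRel.exists_mem_list hp.swap).comp hf Primrec.id

theorem PrimrecPred.forall_mem {f : α → List β} {p : α → β → Prop} (hf : Primrec f)
    (hp : PrimrecRel p) : PrimrecPred fun a => ∀ b ∈ f a, p a b :=
  (PrimrecRel.forall_mem_list hp.swap).comp hf Primrec.id

theorem PrimrecPred.mem {f : α → List β} {g : α → β} (hf : Primrec f) (hg : Primrec g) :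
    PrimrecPred fun a => g a ∈ f a :=
  (PrimrecPred.exists_mem hf (p := fun a b => b = g a)
    (Primrec.eq.comp Primrec.snd (hg.comp Primrec.fst))).of_eq (by simp)

theorem Primrec.filter {f : α → List β} {p : α → β → Prop} [∀ a, DecidablePred (p a)]
    (hf : Primrec f) (hp : PrimrecRel p) : Primrec fun a => (f a).filter (p a ·) := by
  let _ : DecidableRel (Function.swap p) := fun b a => inferInstanceAs (Decidable (p a b))
  exact (PrimrecRel.listFilter hp.swap).comp hf Primrec.id

end Primrec

/-- A finite system: the list of its points, and the list of its transitions, given as triples of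
a source, a modality and a target. -/
abbrev FinSys : Type := List ℕ × List (ℕ × ℕ × ℕ)

/-- A finite assignment of sets of points to variables. -/
abbrev Env : Type := List (ℕ × List ℕ)

namespace FinSys

variable (K : FinSys)

/-- The points of a finite system, as a type. -/
abbrev Point : Type := {k : ℕ // k ∈ K.1}

/-- The transition relations of a finite system. -/
def Rel (l : ℕ) (k k' : K.Point) : Prop := (k.1, l, k'.1) ∈ K.2

/-- The set of points that is given by a list. -/
def toSet (S : List ℕ) : Set K.Point := {k | k.1 ∈ S}

/-- The points with an `l`-transition into `S`. -/
def pre (l : ℕ) (S : List ℕ) : List ℕ :=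
  K.1.filter fun p => ∃ e ∈ K.2, e.1 = p ∧ e.2.1 = l ∧ e.2.2 ∈ S

/-- The value of a variable. -/
def lookup (env : Env) (z : ℕ) : List ℕ := (List.lookup z env).getD []

/-- The list of the points that satisfy a formula; a least fixpoint is computed by iteration from
the empty set, as many times as there are points. -/
def evalList : TFL ℕ → Env → List ℕ
  | .var z, env => lookup env z
  | .neg φ, env => K.1.filter fun p => p ∉ evalList φ env
  | .and φ ψ, env => (evalList φ env).filter fun p => p ∈ evalList ψ env
  | .diaC a φ, env => K.pre (3 * a) (evalList φ env)
  | .diaNC a φ, env => K.pre (3 * a + 1) (evalList φ env)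
  | .diaTrace φ, env => K.pre 2 (evalList φ env)
  | .mu z φ, env => K.1.length.rec [] fun _ S => evalList φ ((z, S) :: env)

end FinSys

/-- On a finite type, the least prefixed point of a monotone operator on sets is reached from the
empty set after as many steps as there are elements. -/
theorem iterate_empty_eq_sInter {X : Type*} [Finite X] {F : Set X → Set X} (hF : Monotone F)
    {n : ℕ} (hn : Nat.card X ≤ n) : F^[n] ∅ = ⋂₀ {Q | F Q ⊆ Q} := by
  have hmono : Monotone fun i => F^[i] ∅ := by
    refine monotone_nat_of_le_succ fun i => ?_
    induction i with
    | zero => exact Set.empty_subset _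
    | succ i ih =>
      simp only [Function.iterate_succ_apply'] at ih ⊢
      exact hF ih
  -- a chain that has not become constant by step `i` has gained an element at each step
  have hcard : ∀ i, F (F^[i] ∅) = F^[i] ∅ ∨ i < (F^[i + 1] ∅).ncard := by
    intro i
    induction i with
    | zero =>
      by_cases h : F ∅ = ∅
      · exact Or.inl h
      · right
        exact (Set.ncard_pos (Set.toFinite _)).2 (Set.nonempty_iff_ne_empty.2 h)
    | succ i ih =>
      by_cases h : F (F^[i + 1] ∅) = F^[i + 1] ∅
      · exact Or.inl h
      · right
        have hlt : F^[i + 1] ∅ ⊂ F^[i + 2] ∅ := by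
          refine (hmono (Nat.le_succ (i + 1))).ssubset_of_ne fun h' => h ?_
          rw [← Function.iterate_succ_apply' F]
          exact h'.symm
        have := Set.ncard_lt_ncard hlt
        rcases ih with ih | ih
        · exact absurd (by rw [Function.iterate_succ_apply', ih, ih]) h
        · exact lt_of_le_of_lt ih this
  have hfix : F (F^[n] ∅) = F^[n] ∅ := by
    refine (hcard n).resolve_right fun h => ?_
    have := Set.ncard_le_card (F^[n + 1] ∅)
    omega
  apply Set.Subset.antisymm
  · refine Set.subset_sInter fun Q hQ => ?_
    have : ∀ i, F^[i] ∅ ⊆ Q := by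
      intro i
      induction i with
      | zero => exact Set.empty_subset _
      | succ i ih => rw [Function.iterate_succ_apply']; exact (hF ih).trans hQ
    exact this n
  · exact Set.sInter_subset_of_mem hfix.subset

namespace FinSys

variable (K : FinSys)

theorem toSet_pre (l : ℕ) (S : List ℕ) (hE : ∀ e ∈ K.2, e.2.2 ∈ K.1) :
    K.toSet (K.pre l S) = {k | ∃ k', K.Rel l k k' ∧ k' ∈ K.toSet S} := by
  ext ⟨k, hk⟩
  simp only [toSet, pre, Rel, Set.mem_ofPred_eq, List.mem_filter, decide_eq_true_eq]
  constructor
  · rintro ⟨_, ⟨_, _, k'⟩, he, rfl, rfl, h⟩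
    exact ⟨⟨k', hE _ he⟩, he, h⟩
  · rintro ⟨k', he, h⟩
    exact ⟨hk, _, he, rfl, rfl, h⟩

/-- The list evaluation is the semantics of formulae over the type of points. -/
theorem toSet_evalList (hE : ∀ e ∈ K.2, e.2.2 ∈ K.1) (φ : TFL ℕ) :
    φ.WellFormed → ∀ env : Env,
      K.toSet (K.evalList φ env) = TFL.den K.Rel φ fun z => K.toSet (lookup env z) := by
  induction φ with
  | var z => intro _ env; rfl
  | neg φ ih =>
    intro h env
    rw [TFL.den, ← ih h env]
    ext ⟨k, hk⟩
    simp [toSet, evalList, hk]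
  | and φ ψ ih₁ ih₂ =>
    intro h env
    rw [TFL.den, ← ih₁ h.1 env, ← ih₂ h.2 env]
    ext ⟨k, hk⟩
    simp [toSet, evalList]
  | diaC a φ ih | diaNC a φ ih | diaTrace φ ih =>
    intro h env
    rw [TFL.den, ← ih h env, evalList, toSet_pre K _ _ hE]
  | mu z φ ih =>
    intro h env
    have hcard : Nat.card K.Point ≤ K.1.length := by
      classical
      rw [← Nat.card_congr (Equiv.subtypeEquivRight fun k => List.mem_toFinset (a := k) (l := K.1)),
        Nat.card_eq_fintype_card, Fintype.card_coe]
      exact List.toFinset_card_le _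
    have : Finite K.Point := (List.finite_toSet K.1).to_subtype
    rw [TFL.den, ← iterate_empty_eq_sInter (TFL.den_update_mono K.Rel h.1 _) hcard, evalList]
    generalize K.1.length = n
    induction n with
    | zero => ext; simp [toSet]
    | succ n ihn =>
      rw [Function.iterate_succ_apply', ← ihn, ih h.2]
      congr 1
      funext i
      by_cases hi : i = z
      · subst hi; simp [lookup]
      · have hb : (i == z) = false := by simpa using hi
        simp [lookup, hi, List.lookup, hb]

end FinSys

/-! ### Computability of the model checker -/

/-- Run the program `c` on the input `a`. -/
def call {α β : Type} [Primcodable α] [Primcodable β] (c : Code) (a : α) : Part β :=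
  (c.eval (Encodable.encode a)).bind fun m => ((Encodable.decode m : Option β) : Part β)

theorem partrec_call {α β : Type} [Primcodable α] [Primcodable β] :
    Partrec₂ (call : Code → α →. β) :=
  (Code.eval_part.comp Computable.fst (Computable.encode.comp Computable.snd)).bind
    (Computable.ofOption (Computable.decode.comp Computable.snd)).to₂

/-- Kleene's recursion theorem, for functions between arbitrary encoded types: a partial recursive
function may be defined in terms of a program for itself. -/
theorem exists_call_eq {α β : Type} [Primcodable α] [Primcodable β] {F : Code → α →. β}
    (hF : Partrec₂ F) : ∃ c : Code, ∀ a, call c a = F c a := by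
  have h : Partrec₂ fun (c : Code) (n : ℕ) =>
      ((Encodable.decode n : Option α) : Part α).bind fun a => (F c a).map Encodable.encode :=
    (Computable.ofOption (Computable.decode.comp Computable.snd)).bind
      ((hF.comp (Computable.fst.comp Computable.fst) Computable.snd).map
        (Computable.encode.comp Computable.snd).to₂).to₂
  obtain ⟨c, hc⟩ := Code.fixed_point₂ h
  refine ⟨c, fun a => ?_⟩
  simp only [call, hc, Encodable.encodek, Part.coe_some, Part.bind_some, Part.bind_map]
  exact Part.bind_some_right _

namespace FinSys

/-- A query `(K, n, i, env)` asks for the value of the formula with code `n` in the system `K`,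
or, if the formula is a least fixpoint, for the `i`-th stage of its iteration. -/
abbrev Query : Type := FinSys × ℕ × ℕ × Env

/-- Whether a query can be answered without evaluating other formulae. -/
def Query.isLeaf (q : Query) : Bool :=
  decide (q.2.1 % 7 = 0) || (decide (q.2.1 % 7 = 6) && decide (q.2.2.1 = 0))

/-- The answer to a leaf query. -/
def Query.leafValue (q : Query) : List ℕ :=
  if q.2.1 % 7 = 0 then lookup q.2.2.2 (q.2.1 / 7) else []

/-- The query for the subformula with code `n`. -/
def Query.sub (q : Query) (n : ℕ) (env : Env) : Query := (q.1, n, q.1.1.length, env)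

/-- The first query that is needed to answer `q`: the previous stage of a fixpoint, or the first
immediate subformula. -/
def Query.first (q : Query) : Query :=
  if q.2.1 % 7 = 6 then (q.1, q.2.1, q.2.2.1 - 1, q.2.2.2)
  else if q.2.1 % 7 = 2 then q.sub (q.2.1 / 7).unpair.1 q.2.2.2
  else if q.2.1 % 7 = 1 ∨ q.2.1 % 7 = 5 then q.sub (q.2.1 / 7) q.2.2.2
  else q.sub (q.2.1 / 7).unpair.2 q.2.2.2

/-- The second query that is needed to answer `q`, given the answer `S` to the first one. For the
unary operators the first query is repeated. -/
def Query.second (q : Query) (S : List ℕ) : Query :=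
  if q.2.1 % 7 = 6 then q.sub (q.2.1 / 7).unpair.2 (((q.2.1 / 7).unpair.1, S) :: q.2.2.2)
  else if q.2.1 % 7 = 2 then q.sub (q.2.1 / 7).unpair.2 q.2.2.2
  else q.first

/-- The answer to the query `q`, given the answers `S` and `T` to the first and second query. -/
def Query.combine (q : Query) (S T : List ℕ) : List ℕ :=
  if q.2.1 % 7 = 6 then T
  else if q.2.1 % 7 = 2 then S.filter fun p => p ∈ T
  else if q.2.1 % 7 = 1 then q.1.1.filter fun p => p ∉ S
  else if q.2.1 % 7 = 3 then q.1.pre (3 * (q.2.1 / 7).unpair.1) S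
  else if q.2.1 % 7 = 4 then q.1.pre (3 * (q.2.1 / 7).unpair.1 + 1) S
  else q.1.pre 2 S

/-- The evaluation of a query with recursive calls to the program `c`. -/
def Query.body (c : Code) (q : Query) : Part (List ℕ) :=
  cond q.isLeaf (Part.some q.leafValue)
    ((call c q.first).bind fun S => (call c (q.second S)).map fun T => q.combine S T)

section

open Primrec

theorem primrec_rem {α : Type*} [Primcodable α] {f : α → ℕ} (hf : Primrec f) (r : ℕ) :
    PrimrecPred fun a => f a % 7 = r :=
  Primrec.eq.comp (nat_mod.comp hf (const 7)) (const r)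

theorem primrec_lookup : Primrec₂ lookup :=
  option_getD.comp (listLookup.comp snd fst) (const [])

theorem primrec_pre {α : Type*} [Primcodable α] {K : α → FinSys} {l : α → ℕ} {S : α → List ℕ}
    (hK : Primrec K) (hl : Primrec l) (hS : Primrec S) : Primrec fun a => (K a).pre (l a) (S a) := by
  refine Primrec.filter (fst.comp hK)
    (PrimrecPred.exists_mem (p := fun (x : α × ℕ) (e : ℕ × ℕ × ℕ) =>
      e.1 = x.2 ∧ e.2.1 = l x.1 ∧ e.2.2 ∈ S x.1) (snd.comp (hK.comp fst)) ?_)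
  exact (Primrec.eq.comp (fst.comp snd) (snd.comp fst)).and
    ((Primrec.eq.comp (fst.comp (snd.comp snd)) (hl.comp (fst.comp fst))).and
      (PrimrecPred.mem (hS.comp (fst.comp fst)) (snd.comp (snd.comp snd))))

theorem primrec_sub {α : Type*} [Primcodable α] {q : α → Query} {n : α → ℕ} {env : α → Env}
    (hq : Primrec q) (hn : Primrec n) (henv : Primrec env) :
    Primrec fun a => (q a).sub (n a) (env a) :=
  (fst.comp hq).pair (hn.pair ((list_length.comp (fst.comp (fst.comp hq))).pair henv))

theorem primrec_number : Primrec fun q : Query => q.2.1 := fst.comp snd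

theorem primrec_arg : Primrec fun q : Query => (q.2.1 / 7).unpair :=
  unpair.comp (nat_div.comp primrec_number (const 7))

theorem primrec_env : Primrec fun q : Query => q.2.2.2 := snd.comp (snd.comp snd)

theorem primrec_isLeaf : Primrec Query.isLeaf :=
  Primrec.or.comp (primrec_rem primrec_number 0).decide
    (Primrec.and.comp (primrec_rem primrec_number 6).decide
      (Primrec.eq.comp (fst.comp (snd.comp snd)) (const 0) :
        PrimrecPred fun q : Query => q.2.2.1 = 0).decide)

theorem primrec_leafValue : Primrec Query.leafValue :=
  ite (primrec_rem primrec_number 0)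
    (primrec_lookup.comp primrec_env (nat_div.comp primrec_number (const 7))) (const [])

theorem primrec_first : Primrec Query.first :=
  ite (primrec_rem primrec_number 6)
    (fst.pair (primrec_number.pair ((nat_sub.comp (fst.comp (snd.comp snd)) (const 1)).pair
      primrec_env)))
    (ite (primrec_rem primrec_number 2)
      (primrec_sub Primrec.id (fst.comp primrec_arg) primrec_env)
      (ite ((primrec_rem primrec_number 1).or (primrec_rem primrec_number 5))
        (primrec_sub Primrec.id (nat_div.comp primrec_number (const 7)) primrec_env)
        (primrec_sub Primrec.id (snd.comp primrec_arg) primrec_env)))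

theorem primrec_second : Primrec₂ Query.second :=
  ite (primrec_rem (primrec_number.comp fst) 6)
    (primrec_sub fst (snd.comp (primrec_arg.comp fst))
      (list_cons.comp ((fst.comp (primrec_arg.comp fst)).pair snd) (primrec_env.comp fst)))
    (ite (primrec_rem (primrec_number.comp fst) 2)
      (primrec_sub fst (snd.comp (primrec_arg.comp fst)) (primrec_env.comp fst))
      (primrec_first.comp fst))

theorem primrec_combine :
    Primrec fun x : (Query × List ℕ) × List ℕ => Query.combine x.1.1 x.1.2 x.2 := by
  have hq : Primrec fun x : (Query × List ℕ) × List ℕ => x.1.1 := fst.comp fst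
  have hS : Primrec fun x : (Query × List ℕ) × List ℕ => x.1.2 := snd.comp fst
  have hr : ∀ r, PrimrecPred fun x : (Query × List ℕ) × List ℕ => x.1.1.2.1 % 7 = r :=
    fun r => primrec_rem (primrec_number.comp hq) r
  have ha : Primrec fun x : (Query × List ℕ) × List ℕ => 3 * (x.1.1.2.1 / 7).unpair.1 :=
    nat_mul.comp (const 3) (fst.comp (primrec_arg.comp hq))
  refine ite (hr 6) snd (ite (hr 2) ?_ (ite (hr 1) ?_ (ite (hr 3) ?_ (ite (hr 4) ?_ ?_))))
  · exact Primrec.filter hS (PrimrecPred.mem (snd.comp fst) snd)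
  · exact Primrec.filter (fst.comp (fst.comp hq)) (PrimrecPred.mem (hS.comp fst) snd).not
  · exact primrec_pre (fst.comp hq) ha hS
  · exact primrec_pre (fst.comp hq) (nat_add.comp ha (const 1)) hS
  · exact primrec_pre (fst.comp hq) (const 2) hS

end

theorem partrec_body : Partrec₂ Query.body := by
  have h₁ : Partrec fun x : Code × Query => (call x.1 x.2.first : Part (List ℕ)) :=
    partrec_call.comp Computable.fst (primrec_first.to_comp.comp Computable.snd)
  have h₂ : Partrec fun x : (Code × Query) × List ℕ =>
      (call x.1.1 (x.1.2.second x.2) : Part (List ℕ)) :=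
    partrec_call.comp (Computable.fst.comp Computable.fst)
      (primrec_second.to_comp.comp (Computable.snd.comp Computable.fst) Computable.snd)
  have h₃ : Computable₂ fun (x : (Code × Query) × List ℕ) (T : List ℕ) =>
      x.1.2.combine x.2 T :=
    Computable.comp (f := fun x : (Query × List ℕ) × List ℕ => x.1.1.combine x.1.2 x.2)
      (g := fun x : ((Code × Query) × List ℕ) × List ℕ => ((x.1.1.2, x.1.2), x.2))
      primrec_combine.to_comp
      (((Computable.snd.comp (Computable.fst.comp Computable.fst)).pair
        (Computable.snd.comp Computable.fst)).pair Computable.snd)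
  have h₄ : Partrec fun x : Code × Query =>
      (call x.1 x.2.first : Part (List ℕ)).bind fun S =>
        (call x.1 (x.2.second S) : Part (List ℕ)).map fun T => x.2.combine S T :=
    h₁.bind (h₂.map h₃).to₂
  exact Partrec.cond (primrec_isLeaf.to_comp.comp Computable.snd)
    (primrec_leafValue.to_comp.comp Computable.snd).partrec h₄

/-- The intended answer to the query `(K, φ.code, i, env)`. -/
def stage (K : FinSys) : TFL ℕ → ℕ → Env → List ℕ
  | .mu z φ, i, env => i.rec [] fun _ S => K.evalList φ ((z, S) :: env)
  | φ, _, env => K.evalList φ env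

theorem stage_length (K : FinSys) (φ : TFL ℕ) (env : Env) :
    stage K φ K.1.length env = K.evalList φ env := by
  cases φ <;> rfl

/-- A program that satisfies the recursion `Query.body` answers all queries as intended. The proof is
by induction on the formula and, for least fixpoints, on the stage. -/
theorem call_eq_stage {c : Code} (hc : ∀ q : Query, call c q = Query.body c q) (K : FinSys)
    (φ : TFL ℕ) :
    ∀ i env, call c ((K, φ.code, i, env) : Query) = Part.some (stage K φ i env) := by
  have h7 : ∀ n r, r < 7 → (7 * n + r) % 7 = r ∧ (7 * n + r) / 7 = n := by omega
  induction φ with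
  | var z =>
    intro i env
    obtain ⟨hr, hd⟩ := h7 z 0 (by norm_num)
    rw [Nat.add_zero] at hr hd
    rw [hc]
    simp [Query.body, Query.isLeaf, Query.leafValue, TFL.code, hr, stage, evalList]
  | neg φ ih | diaTrace φ ih =>
    intro i env
    have h := ih K.1.length env
    rw [stage_length] at h
    rw [hc]
    simp [Query.body, Query.isLeaf, TFL.code, h7, Query.first, Query.second,
      Query.combine, Query.sub, h, stage, evalList]
  | and φ ψ ih₁ ih₂ =>
    intro i env
    have h₁ := ih₁ K.1.length env
    have h₂ := ih₂ K.1.length env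
    rw [stage_length] at h₁ h₂
    rw [hc]
    simp [Query.body, Query.isLeaf, TFL.code, h7, Query.first, Query.second,
      Query.combine, Query.sub, h₁, h₂, stage, evalList]
  | diaC a φ ih | diaNC a φ ih =>
    intro i env
    have h := ih K.1.length env
    rw [stage_length] at h
    rw [hc]
    simp [Query.body, Query.isLeaf, TFL.code, h7, Query.first, Query.second,
      Query.combine, Query.sub, h, stage, evalList]
  | mu z φ ih =>
    intro i env
    induction i with
    | zero =>
      rw [hc]
      simp [Query.body, Query.isLeaf, Query.leafValue, TFL.code, h7, stage]
    | succ i ihi =>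
      have h := ih K.1.length ((z, stage K (.mu z φ) i env) :: env)
      rw [stage_length] at h
      rw [TFL.code] at ihi
      rw [hc]
      simp [Query.body, Query.isLeaf, TFL.code, h7, Query.first, Query.second,
        Query.combine, Query.sub, ihi, h]
      rfl

end FinSys

/-- Every number is the code of a formula, so the evaluation terminates on all inputs. -/
theorem TFL.code_surjective : Function.Surjective TFL.code := by
  intro n
  induction n using Nat.strong_induction_on with
  | _ n ih =>
    have h₁ : ∀ r, 0 < r → n % 7 = r → n / 7 < n := by omega
    have h₂ : ∀ r, 0 < r → n % 7 = r → (n / 7).unpair.1 < n :=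
      fun r h h' => (Nat.unpair_left_le _).trans_lt (h₁ r h h')
    have h₃ : ∀ r, 0 < r → n % 7 = r → (n / 7).unpair.2 < n :=
      fun r h h' => (Nat.unpair_right_le _).trans_lt (h₁ r h h')
    have h₄ : n % 7 < 7 := Nat.mod_lt _ (by norm_num)
    obtain h | h | h | h | h | h | h : n % 7 = 0 ∨ n % 7 = 1 ∨ n % 7 = 2 ∨ n % 7 = 3 ∨ n % 7 = 4 ∨
      n % 7 = 5 ∨ n % 7 = 6 := by omega
    · exact ⟨.var (n / 7), by rw [TFL.code]; omega⟩
    · obtain ⟨φ, hφ⟩ := ih _ (h₁ _ (by norm_num) h)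
      exact ⟨.neg φ, by rw [TFL.code]; omega⟩
    · obtain ⟨φ, hφ⟩ := ih _ (h₂ _ (by norm_num) h)
      obtain ⟨ψ, hψ⟩ := ih _ (h₃ _ (by norm_num) h)
      exact ⟨.and φ ψ, by rw [TFL.code, hφ, hψ, Nat.pair_unpair]; omega⟩
    · obtain ⟨φ, hφ⟩ := ih _ (h₃ _ (by norm_num) h)
      exact ⟨.diaC (n / 7).unpair.1 φ, by rw [TFL.code, hφ, Nat.pair_unpair]; omega⟩
    · obtain ⟨φ, hφ⟩ := ih _ (h₃ _ (by norm_num) h)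
      exact ⟨.diaNC (n / 7).unpair.1 φ, by rw [TFL.code, hφ, Nat.pair_unpair]; omega⟩
    · obtain ⟨φ, hφ⟩ := ih _ (h₁ _ (by norm_num) h)
      exact ⟨.diaTrace φ, by rw [TFL.code]; omega⟩
    · obtain ⟨φ, hφ⟩ := ih _ (h₃ _ (by norm_num) h)
      exact ⟨.mu (n / 7).unpair.1 φ, by rw [TFL.code, hφ, Nat.pair_unpair]; omega⟩

/-- The model checker: a computable function that decides whether a point of a finite system
satisfies the formula with a given code. Open formulae are evaluated under some fixed valuation
`W`, which does not matter for specifications. -/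
theorem FinSys.exists_modelChecker : ∃ mc : FinSys × ℕ × ℕ → Bool, Computable mc ∧
    ∀ (K : FinSys) (k : K.Point), (∀ e ∈ K.2, e.2.2 ∈ K.1) → ∀ φ : TFL ℕ, φ.WellFormed →
      ∃ W : ℕ → Set K.Point, mc (K, k.1, φ.code) = true ↔ k ∈ TFL.den K.Rel φ W := by
  obtain ⟨c, hc⟩ := exists_call_eq FinSys.partrec_body
  choose form hform using TFL.code_surjective
  have hcomp : Computable fun x : FinSys × ℕ × ℕ => x.1.evalList (form x.2.2) [] := by
    refine Partrec.of_eq (f := fun x : FinSys × ℕ × ℕ =>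
      call c ((x.1, x.2.2, x.1.1.length, []) : FinSys.Query))
      (partrec_call.comp (Computable.const c)
      (Computable.fst.pair ((Computable.snd.comp Computable.snd).pair
        ((Computable.list_length.comp (Computable.fst.comp Computable.fst)).pair
          (Computable.const []))))) fun x => ?_
    change _ = Part.some (x.1.evalList (form x.2.2) [])
    rw [← FinSys.stage_length, ← FinSys.call_eq_stage hc, hform]
  refine ⟨fun x => decide (x.2.1 ∈ x.1.evalList (form x.2.2) []), ?_, ?_⟩
  · have : PrimrecPred fun x : List ℕ × ℕ => x.2 ∈ x.1 := PrimrecPred.mem Primrec.fst Primrec.snd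
    exact this.decide.to_comp.comp (hcomp.pair (Computable.fst.comp Computable.snd))
  · intro K k hE φ hφ
    refine ⟨fun z => K.toSet (FinSys.lookup [] z), ?_⟩
    rw [← K.toSet_evalList hE φ hφ []]
    simp only [TFL.code_injective (hform φ.code), decide_eq_true_eq]
    rfl

/-! ### Futures of configurations -/

namespace EventStructure

variable {α : Type u} {E : EventStructure α ℕ} {C C' C'' D D' : E.Config} {e e' d : α}

theorem Config.ext_events (h : ∀ x, x ∈ C.events ↔ x ∈ D.events) : C = D := by
  cases C; cases D
  congr
  exact Finset.ext h

theorem Step.events_eq_cons (h : Step C e C') : C'.events = C.events.cons e h.1 := by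
  ext x
  rw [h.2, Finset.mem_cons, or_comm]

theorem Step.target_unique (h : Step C e C') (h' : Step C e C'') : C' = C'' :=
  Config.ext_events fun x => by rw [h.2, h'.2]

theorem Step.event_unique (h : Step C e C') (h' : Step C e' C') : e = e' := by
  have := (h'.2 e).1 ((h.2 e).2 (Or.inr rfl))
  exact this.resolve_left h.1

/-- The events that can occur at `C` are the minimal events of its future. -/
theorem enabled_iff :
    Enabled C e ↔ e ∈ future C ∧ ∀ e' ∈ future C, E.le e' e → e' = e := by
  constructor
  · rintro ⟨C', h, h'⟩
    have he : e ∈ C'.events := (h' e).2 (Or.inr rfl)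
    refine ⟨⟨h, fun x hx => C'.conflict_free x ((h' x).2 (Or.inl hx)) e he⟩, fun x hx hxe => ?_⟩
    exact ((h' x).1 (C'.down_closed e he x hxe)).resolve_left hx.1
  · rintro ⟨⟨h, hc⟩, hmin⟩
    have hdown : ∀ x, E.le x e → x ∈ C.events ∨ x = e := by
      intro x hx
      by_contra! hne
      refine hne.2 (hmin x ⟨hne.1, fun y hy hyx => hc y hy (E.conflict_inherit y x e hyx hx)⟩ hx)
    refine ⟨⟨C.events.cons e h, ?_, ?_⟩, h, fun x => by simp [or_comm]⟩
    · intro x hx y hy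
      rcases Finset.mem_cons.1 hx with rfl | hx <;> rcases Finset.mem_cons.1 hy with rfl | hy
      · exact E.conflict_irrefl _
      · exact fun hxy => hc y hy (E.conflict_symm _ _ hxy)
      · exact hc x (by assumption)
      · exact C.conflict_free x hx y hy
    · intro x hx y hyx
      rw [Finset.mem_cons]
      rcases Finset.mem_cons.1 hx with rfl | hx
      · exact (hdown y hyx).symm
      · exact Or.inr (C.down_closed x hx y hyx)

theorem Enabled.mem_future (h : Enabled C e) : e ∈ future C := (enabled_iff.1 h).1

theorem Step.mem_future_iff (h : Step C e C') (x : α) :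
    x ∈ future C' ↔ x ∈ future C ∧ x ≠ e ∧ ¬ E.conflict e x := by
  constructor
  · rintro ⟨hx, hc⟩
    exact ⟨⟨fun hx' => hx ((h.2 x).2 (Or.inl hx')), fun y hy => hc y ((h.2 y).2 (Or.inl hy))⟩,
      fun hx' => hx ((h.2 x).2 (Or.inr hx')), hc e ((h.2 e).2 (Or.inr rfl))⟩
  · rintro ⟨⟨hx, hc⟩, hne, hce⟩
    refine ⟨fun hx' => ((h.2 x).1 hx').elim hx hne, fun y hy => ?_⟩
    rcases (h.2 y).1 hy with hy | rfl
    · exact hc y hy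
    · exact hce

/-- Two events that can occur at `C` are concurrent iff one can occur after the other. -/
theorem Step.co_iff_enabled (h : Step C e C') (he' : Enabled C e') (hne : e ≠ e') :
    E.co e e' ↔ Enabled C' e' := by
  have he : Enabled C e := ⟨C', h⟩
  rw [enabled_iff] at he he' ⊢
  constructor
  · rintro ⟨_, _, hc⟩
    exact ⟨(h.mem_future_iff e').2 ⟨he'.1, hne.symm, hc⟩,
      fun x hx => he'.2 x ((h.mem_future_iff x).1 hx).1⟩
  · rintro ⟨h', _⟩
    exact ⟨fun hle => hne (he'.2 e he.1 hle), fun hle => hne.symm (he.2 e' he'.1 hle),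
      ((h.mem_future_iff e').1 h').2.2⟩

/-- An event that can occur after `d` is concurrent with `d` iff it could already occur before. -/
theorem Step.co_iff_enabled_source (h : Step C d C') (he : Enabled C' e) :
    E.co d e ↔ Enabled C e := by
  have hf := (h.mem_future_iff e).1 he.mem_future
  constructor
  · rintro ⟨h₁, _, h₃⟩
    refine enabled_iff.2 ⟨hf.1, fun x hx hxe => ?_⟩
    refine (enabled_iff.1 he).2 x ((h.mem_future_iff x).2 ⟨hx, ?_, ?_⟩) hxe
    · rintro rfl; exact h₁ hxe
    · exact fun hc => h₃ (E.conflict_inherit _ _ _ hc hxe)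
  · intro he'
    exact (h.co_iff_enabled he' hf.2.1.symm).2 he

/-- The map `g` restricts to an isomorphism between the futures of `C` and `D`; its values outside
of the future of `C` do not matter. -/
structure FutIso (g : α → α) (C D : E.Config) : Prop where
  bijOn : Set.BijOn g (future C) (future D)
  le_iff : ∀ x ∈ future C, ∀ y ∈ future C, E.le (g x) (g y) ↔ E.le x y
  conflict_iff : ∀ x ∈ future C, ∀ y ∈ future C, E.conflict (g x) (g y) ↔ E.conflict x y
  label_eq : ∀ x ∈ future C, E.label (g x) = E.label x

theorem FutureIso.exists_futIso (h : FutureIso C D) : ∃ g : α → α, FutIso g C D := by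
  classical
  obtain ⟨f, h₁, h₂, h₃⟩ := h
  have hg : ∀ x (hx : x ∈ future C),
      (if hx : x ∈ future C then (f ⟨x, hx⟩ : α) else x) = f ⟨x, hx⟩ := fun x hx => dif_pos hx
  refine ⟨fun x => if hx : x ∈ future C then f ⟨x, hx⟩ else x, ⟨?_, ?_, ?_⟩, ?_, ?_, ?_⟩
  · intro x hx
    simp only [hg x hx, Subtype.coe_prop]
  · intro x hx y hy hxy
    simp only [hg x hx, hg y hy] at hxy
    simpa using f.injective (Subtype.ext hxy)
  · intro y hy
    refine ⟨f.symm ⟨y, hy⟩, (f.symm ⟨y, hy⟩).2, ?_⟩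
    refine (hg _ (f.symm ⟨y, hy⟩).2).trans ?_
    simp only [Subtype.coe_eta, Equiv.apply_symm_apply]
  · intro x hx y hy
    simp only [hg x hx, hg y hy]
    exact h₁ ⟨x, hx⟩ ⟨y, hy⟩
  · intro x hx y hy
    simp only [hg x hx, hg y hy]
    exact h₂ ⟨x, hx⟩ ⟨y, hy⟩
  · intro x hx
    simp only [hg x hx]
    exact h₃ ⟨x, hx⟩

namespace FutIso

variable {g : α → α}

theorem enabled_iff_enabled (hg : FutIso g C D) (he : e ∈ future C) :
    Enabled D (g e) ↔ Enabled C e := by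
  rw [enabled_iff, enabled_iff]
  constructor
  · rintro ⟨_, h⟩
    exact ⟨he, fun x hx hxe => hg.bijOn.injOn hx he
      (h _ (hg.bijOn.mapsTo hx) ((hg.le_iff x hx e he).2 hxe))⟩
  · rintro ⟨_, h⟩
    refine ⟨hg.bijOn.mapsTo he, fun y hy hye => ?_⟩
    obtain ⟨x, hx, rfl⟩ := hg.bijOn.surjOn hy
    rw [h x hx ((hg.le_iff x hx e he).1 hye)]

theorem enabled_iff_exists (hg : FutIso g C D) (d : α) :
    Enabled D d ↔ ∃ e, Enabled C e ∧ g e = d := by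
  constructor
  · intro hd
    obtain ⟨e, he, rfl⟩ := hg.bijOn.surjOn hd.mem_future
    exact ⟨e, (hg.enabled_iff_enabled he).1 hd, rfl⟩
  · rintro ⟨e, he, rfl⟩
    exact (hg.enabled_iff_enabled he.mem_future).2 he

theorem co_iff (hg : FutIso g C D) (he : e ∈ future C) (he' : e' ∈ future C) :
    E.co (g e) (g e') ↔ E.co e e' := by
  simp only [co, hg.le_iff e he e' he', hg.le_iff e' he' e he, hg.conflict_iff e he e' he']

/-- An isomorphism of futures persists when corresponding events occur. -/
theorem step (hg : FutIso g C D) (h : Step C e C') (h' : Step D (g e) D') : FutIso g C' D' := by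
  have he : e ∈ future C := Enabled.mem_future ⟨C', h⟩
  have hsub : ∀ x ∈ future C', x ∈ future C := fun x hx => ((h.mem_future_iff x).1 hx).1
  refine ⟨⟨?_, hg.bijOn.injOn.mono hsub, ?_⟩, fun x hx y hy => hg.le_iff x (hsub x hx) y (hsub y hy),
    fun x hx y hy => hg.conflict_iff x (hsub x hx) y (hsub y hy),
    fun x hx => hg.label_eq x (hsub x hx)⟩
  · intro x hx
    obtain ⟨hx, hne, hc⟩ := (h.mem_future_iff x).1 hx
    refine (h'.mem_future_iff _).2 ⟨hg.bijOn.mapsTo hx, fun h => hne (hg.bijOn.injOn hx he h), ?_⟩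
    rwa [hg.conflict_iff e he x hx]
  · intro y hy
    obtain ⟨hy, hne, hc⟩ := (h'.mem_future_iff y).1 hy
    obtain ⟨x, hx, rfl⟩ := hg.bijOn.surjOn hy
    refine ⟨x, (h.mem_future_iff x).2 ⟨hx, fun h => hne (h ▸ rfl), ?_⟩, rfl⟩
    rwa [← hg.conflict_iff e he x hx]

end FutIso

/-! ### Processes in terms of events -/

/-- The set of the events that can occur at a configuration. -/
noncomputable def enabledSet (hfin : E.ImageFinite) (C : E.Config) : Finset α := (hfin C).toFinset

@[simp] theorem mem_enabledSet {hfin : E.ImageFinite} : e ∈ enabledSet hfin C ↔ Enabled C e := by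
  simp [enabledSet]

variable (E) in
/-- The data of a process that matter for its behaviour: the current configuration, the set of the
events that could already occur before the last transition (those of them that are still enabled
are concurrent with it), and the events of the support set. -/
@[ext] structure Position where
  config : E.Config
  past : Finset α
  supp : Finset α

variable (E) in
/-- `M` is a maximal set of pairwise concurrent events in `P`. -/
def IsTrace (P M : Finset α) : Prop :=
  M ⊆ P ∧ (∀ e ∈ M, ∀ e' ∈ M, e ≠ e' → E.co e e') ∧ ∀ e ∈ P, e ∉ M → ∃ e' ∈ M, ¬ E.co e e'

namespace Position

/-- All events of the support set can occur at the current configuration. -/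
def Valid (p : E.Position) : Prop := ∀ e ∈ p.supp, Enabled p.config e

/-- The initial position. -/
noncomputable def initial (hfin : E.ImageFinite) : E.Position :=
  ⟨Config.empty E, ∅, enabledSet hfin (Config.empty E)⟩

/-- The position after the occurrence of an event that leads to `C'`. -/
noncomputable def after (hfin : E.ImageFinite) (p : E.Position) (C' : E.Config) : E.Position :=
  ⟨C', enabledSet hfin p.config, enabledSet hfin C'⟩

open Classical in
/-- The modality of the occurrence of the event `e`. -/
noncomputable def modality (p : E.Position) (e : α) : ℕ :=
  3 * E.label e + if e ∈ p.past then 1 else 0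

/-- The transition relations between positions: an event of the support set occurs, or the support
set is narrowed to one of its traces. -/
def Rel (hfin : E.ImageFinite) (l : ℕ) (p q : E.Position) : Prop :=
  (∃ e C', e ∈ p.supp ∧ Step p.config e C' ∧ l = p.modality e ∧ q = p.after hfin C') ∨
  l = 2 ∧ ∃ M, E.IsTrace p.supp M ∧ q = ⟨p.config, p.past, M⟩

variable {hfin : E.ImageFinite}

theorem valid_initial : (initial hfin).Valid := fun _ he => mem_enabledSet.1 he

theorem valid_after (p : E.Position) (C' : E.Config) : (p.after hfin C').Valid :=
  fun _ he => mem_enabledSet.1 he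

theorem Valid.of_rel {l : ℕ} {p q : E.Position} (hp : p.Valid) (h : Rel hfin l p q) :
    q.Valid := by
  rcases h with ⟨e, C', _, _, _, rfl⟩ | ⟨_, M, hM, rfl⟩
  · exact valid_after _ _
  · exact fun e he => hp e (hM.1 he)

theorem valid_of_reach : ∀ p ∈ LTS.Reach (Rel hfin) (initial hfin), p.Valid :=
  LTS.reach_induction valid_initial fun _ _ _ => Valid.of_rel

theorem finBranching {I : Set E.Position} : LTS.FinBranching (Rel hfin) I := by
  intro p _
  have h₁ : ((p.supp : Set α) ×ˢ {C' : E.Config | ∃ e ∈ p.supp, Step p.config e C'}).Finite := by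
    refine p.supp.finite_toSet.prod (Set.Finite.subset (p.supp.finite_toSet.biUnion
      (t := fun e => {C' | Step p.config e C'}) fun e _ => ?_) ?_)
    · exact Set.Subsingleton.finite fun C h C' h' => Step.target_unique h h'
    · rintro C' ⟨e, he, h⟩
      exact Set.mem_biUnion (Finset.mem_coe.2 he) h
  have h₂ : {M : Finset α | E.IsTrace p.supp M}.Finite :=
    (p.supp.powerset.finite_toSet).subset fun M hM => Finset.mem_coe.2 (Finset.mem_powerset.2 hM.1)
  refine ((h₁.image fun x => (p.modality x.1, p.after hfin x.2)).union
    (h₂.image fun M => (2, (⟨p.config, p.past, M⟩ : E.Position)))).subset ?_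
  rintro ⟨l, q⟩ (⟨e, C', he, hC, hl, hq⟩ | ⟨hl, M, hM, hq⟩)
  · exact Or.inl ⟨(e, C'), ⟨he, e, he, hC⟩, by simp_all⟩
  · exact Or.inr ⟨M, hM, by simp_all⟩

end Position

end EventStructure

namespace System

variable {T : System.{u, 0} ℕ}

/-- The transition relations between processes that interpret the modalities of the logic. -/
def procRel (l : ℕ) (p q : T.Proc) : Prop :=
  (∃ r ∈ p.1.1, (l = 3 * lbl r ∧ CausDep p.2 r ∨ l = 3 * lbl r + 1 ∧ LinConc p.2 r) ∧
    q = T.maxProc (tgt r) (some r)) ∨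
  l = 2 ∧ CompleteTrace q.1.1 p.1.1 ∧ q.2 = p.2

theorem denote_eq_den (φ : TFL ℕ) : ∀ V, T.denote φ V = TFL.den procRel φ V := by
  induction φ with
  | var z => intro V; rfl
  | neg φ ih => intro V; rw [denote, ih]; rfl
  | and φ ψ ih₁ ih₂ => intro V; rw [denote, ih₁, ih₂]; rfl
  | diaC a φ ih =>
    intro V
    ext p
    simp only [denote, ih, TFL.den, Set.mem_ofPred_eq, procRel]
    constructor
    · rintro ⟨r, hr, rfl, hc, h⟩
      exact ⟨_, Or.inl ⟨r, hr, Or.inl ⟨rfl, hc⟩, rfl⟩, h⟩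
    · rintro ⟨q, ⟨r, hr, (⟨hl, hc⟩ | ⟨hl, hc⟩), rfl⟩ | ⟨hl, _⟩, h⟩
      · exact ⟨r, hr, by omega, hc, h⟩
      all_goals omega
  | diaNC a φ ih =>
    intro V
    ext p
    simp only [denote, ih, TFL.den, Set.mem_ofPred_eq, procRel]
    constructor
    · rintro ⟨r, hr, rfl, hc, h⟩
      exact ⟨_, Or.inl ⟨r, hr, Or.inr ⟨rfl, hc⟩, rfl⟩, h⟩
    · rintro ⟨q, ⟨r, hr, (⟨hl, hc⟩ | ⟨hl, hc⟩), rfl⟩ | ⟨hl, _⟩, h⟩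
      · omega
      · exact ⟨r, hr, by omega, hc, h⟩
      · omega
  | diaTrace φ ih =>
    intro V
    ext p
    simp only [denote, ih, TFL.den, Set.mem_ofPred_eq, procRel]
    constructor
    · rintro ⟨M, hM, h⟩
      exact ⟨(M, p.2), Or.inr ⟨trivial, hM, rfl⟩, h⟩
    · rintro ⟨q, ⟨r, hr, (⟨hl, hc⟩ | ⟨hl, hc⟩), rfl⟩ | ⟨_, hM, h'⟩, h⟩
      · omega
      · omega
      · exact ⟨q.1, hM, h' ▸ h⟩
  | mu z φ ih => intro V; simp only [denote, ih, TFL.den]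

end System

namespace EventStructure

variable {α : Type u} {E : EventStructure α ℕ}

open System

/-- The event that occurs in a transition. -/
noncomputable def ev (t : E.toSystem.Tr) : α := t.2.choose

theorem lbl_eq (t : E.toSystem.Tr) : lbl t = E.label (ev t) := t.2.choose_spec.1

theorem step_ev (t : E.toSystem.Tr) : Step (src t : E.Config) (ev t) (tgt t) := t.2.choose_spec.2

theorem tr_ext {t r : E.toSystem.Tr} (hs : src t = src r) (he : ev t = ev r) : t = r := by
  have h₁ := step_ev t
  have h₂ := lbl_eq t
  rw [he, ← lbl_eq] at h₂
  rw [hs, he] at h₁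
  exact Subtype.ext (Prod.ext hs (Prod.ext h₂ (h₁.target_unique (step_ev r))))

theorem exists_tr {C C' : E.Config} {e : α} (h : Step C e C') :
    ∃ t : E.toSystem.Tr, src t = C ∧ ev t = e ∧ tgt t = C' := by
  refine ⟨⟨(C, E.label e, C'), e, rfl, h⟩, rfl, ?_, rfl⟩
  exact (step_ev (E := E) ⟨(C, E.label e, C'), e, rfl, h⟩).event_unique h

theorem indep_iff (t r : E.toSystem.Tr) : E.toSystem.indep t r ↔ E.co (ev t) (ev r) := by
  constructor
  · rintro ⟨e₁, e₂, hco, _, _, h₁, h₂⟩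
    rwa [(step_ev t).event_unique h₁, (step_ev r).event_unique h₂]
  · intro h
    exact ⟨_, _, h, lbl_eq t, lbl_eq r, step_ev t, step_ev r⟩

theorem immConc_iff (t r : E.toSystem.Tr) :
    ImmConc t r ↔ src t = src r ∧ E.co (ev t) (ev r) := and_congr_right fun _ => indep_iff t r

/-- The position `x` describes the process `p`. -/
def Describes (p : E.toSystem.Proc) (x : E.Position) : Prop :=
  (p.2 = none ∧ x.config = Config.empty E ∧ x.past = ∅ ∨
    ∃ t, p.2 = some t ∧ tgt t = x.config ∧ ∀ e, e ∈ x.past ↔ Enabled (src t : E.Config) e) ∧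
  x.Valid ∧ ∀ r, r ∈ p.1.1 ↔ src r = x.config ∧ ev r ∈ x.supp

theorem Describes.unique {p : E.toSystem.Proc} {x y : E.Position} (hx : Describes p x)
    (hy : Describes p y) : x = y := by
  have h : x.config = y.config ∧ x.past = y.past := by
    rcases hx.1 with ⟨h, h₁, h₂⟩ | ⟨t, h, h₁, h₂⟩ <;>
      rcases hy.1 with ⟨h', h₁', h₂'⟩ | ⟨t', h', h₁', h₂'⟩
    · exact ⟨h₁.trans h₁'.symm, h₂.trans h₂'.symm⟩
    · simp [h] at h'
    · simp [h] at h'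
    · obtain rfl : t = t' := Option.some.inj (h.symm.trans h')
      exact ⟨h₁.symm.trans h₁', Finset.ext fun e => (h₂ e).trans (h₂' e).symm⟩
  have half : ∀ {x y : E.Position}, Describes p x → Describes p y → x.supp ⊆ y.supp := by
    intro x y hx hy e he
    obtain ⟨C', hC'⟩ := hx.2.1 e he
    obtain ⟨r, hr, rfl, _⟩ := exists_tr hC'
    exact ((hy.2.2 r).1 ((hx.2.2 r).2 ⟨hr, he⟩)).2
  exact Position.ext h.1 h.2 (Finset.Subset.antisymm (half hx hy) (half hy hx))

/-- Causal and non-causal dependence on the last transition are read off from the set `past`. -/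
theorem Describes.modality {p : E.toSystem.Proc} {x : E.Position} (hx : Describes p x)
    {r : E.toSystem.Tr} (hr : r ∈ p.1.1) (l : ℕ) :
    (l = 3 * lbl r ∧ CausDep p.2 r ∨ l = 3 * lbl r + 1 ∧ LinConc p.2 r) ↔
      l = x.modality (ev r) := by
  obtain ⟨hs, hr⟩ := (hx.2.2 r).1 hr
  have h : (CausDep p.2 r ↔ ev r ∉ x.past) ∧ (LinConc p.2 r ↔ ev r ∈ x.past) := by
    rcases hx.1 with ⟨h, h₁, h₂⟩ | ⟨t, h, h₁, h₂⟩
    · have hi : src r = E.toSystem.init := hs.trans h₁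
      rw [h, h₂]
      simp [CausDep, LinConc, hi]
    · have hco : E.toSystem.indep t r ↔ ev r ∈ x.past := by
        rw [indep_iff, h₂]
        exact (step_ev t).co_iff_enabled_source (by rw [h₁]; exact hx.2.1 _ hr)
      have ht : tgt t = src r := h₁.trans hs.symm
      simp [h, CausDep, LinConc, hco, ht]
  rw [h.1, h.2, Position.modality, lbl_eq]
  split_ifs with h' <;> simp [h']

theorem describes_maxProc {hfin : E.ImageFinite} {x : E.Position}
    {r : E.toSystem.Tr} (hs : src r = x.config) :
    Describes (E.toSystem.maxProc (tgt r) (some r)) (x.after hfin (tgt r)) := by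
  refine ⟨Or.inr ⟨r, rfl, rfl, fun e => ?_⟩, Position.valid_after _ _, fun t => ?_⟩
  · rw [hs]; exact mem_enabledSet
  · constructor
    · intro ht
      have ht : src t = tgt r := ht
      exact ⟨ht, mem_enabledSet.2 ⟨tgt t, ht ▸ step_ev t⟩⟩
    · exact fun ht => ht.1

theorem describes_initProc {hfin : E.ImageFinite} :
    Describes E.toSystem.initProc (Position.initial hfin) := by
  refine ⟨Or.inl ⟨rfl, rfl, rfl⟩, Position.valid_initial, fun t => ?_⟩
  constructor
  · intro ht
    have ht : src t = Config.empty E := ht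
    exact ⟨ht, mem_enabledSet.2 ⟨tgt t, ht ▸ step_ev t⟩⟩
  · exact fun ht => ht.1

theorem Describes.zig {hfin : E.ImageFinite} (l : ℕ) (p q : E.toSystem.Proc) (x : E.Position)
    (hx : Describes p x) (h : procRel l p q) :
    ∃ y, Position.Rel hfin l x y ∧ Describes q y := by
  classical
  rcases h with ⟨r, hr, hl, rfl⟩ | ⟨rfl, hM, hq⟩
  · rw [hx.modality hr] at hl
    obtain ⟨hs, he⟩ := (hx.2.2 r).1 hr
    exact ⟨x.after hfin (tgt r), Or.inl ⟨ev r, tgt r, he, hs ▸ step_ev r, hl, rfl⟩,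
      describes_maxProc hs⟩
  · obtain ⟨_, hcf, hsub, hmax⟩ := hM
    set M := x.supp.filter fun e => ∃ r ∈ q.1.1, ev r = e
    have hmem : ∀ r, r ∈ q.1.1 ↔ src r = x.config ∧ ev r ∈ M := by
      intro r
      constructor
      · intro hr
        have := (hx.2.2 r).1 (hsub hr)
        exact ⟨this.1, Finset.mem_filter.2 ⟨this.2, r, hr, rfl⟩⟩
      · rintro ⟨hs, hr⟩
        obtain ⟨_, t, ht, he⟩ := Finset.mem_filter.1 hr
        have := (hx.2.2 t).1 (hsub ht)
        exact tr_ext (this.1.trans hs.symm) he ▸ ht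
    have hex : ∀ e ∈ x.supp, ∃ r ∈ p.1.1, src r = x.config ∧ ev r = e := by
      intro e he
      obtain ⟨C', hC'⟩ := hx.2.1 e he
      obtain ⟨r, hr, rfl, _⟩ := exists_tr hC'
      exact ⟨r, (hx.2.2 r).2 ⟨hr, he⟩, hr, rfl⟩
    have htr : E.IsTrace x.supp M := by
      refine ⟨Finset.filter_subset _ _, fun e he e' he' hne => ?_, fun e he he' => ?_⟩
      · obtain ⟨r, _, hs, rfl⟩ := hex e (Finset.mem_filter.1 he).1
        obtain ⟨r', _, hs', rfl⟩ := hex e' (Finset.mem_filter.1 he').1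
        exact ((immConc_iff _ _).1 (hcf r ((hmem r).2 ⟨hs, he⟩) r' ((hmem r').2 ⟨hs', he'⟩)
          fun h => hne (h ▸ rfl))).2
      · obtain ⟨r, hr, hs, rfl⟩ := hex e he
        by_contra! hco
        refine hmax ⟨r, ⟨hr, fun hr' => he' ((hmem r).1 hr').2⟩, fun t ht => ?_⟩
        obtain ⟨hs', ht'⟩ := (hmem t).1 ht
        exact (immConc_iff _ _).2 ⟨hs.trans hs'.symm, hco _ ht'⟩
    refine ⟨⟨x.config, x.past, M⟩, Or.inr ⟨rfl, M, htr, rfl⟩, ?_, fun e he => hx.2.1 e (htr.1 he),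
      hmem⟩
    rw [hq]
    exact hx.1

theorem Describes.zag {hfin : E.ImageFinite} (l : ℕ) (p : E.toSystem.Proc) (x y : E.Position)
    (hx : Describes p x) (h : Position.Rel hfin l x y) :
    ∃ q, procRel l p q ∧ Describes q y := by
  rcases h with ⟨e, C', he, hC', hl, rfl⟩ | ⟨rfl, M, hM, rfl⟩
  · obtain ⟨r, hs, rfl, rfl⟩ := exists_tr hC'
    have hr := (hx.2.2 r).2 ⟨hs, he⟩
    exact ⟨_, Or.inl ⟨r, hr, (hx.modality hr l).2 hl, rfl⟩, describes_maxProc hs⟩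
  · let R : Set E.toSystem.Tr := {r | src r = x.config ∧ ev r ∈ M}
    have hsub : R ⊆ p.1.1 := fun r hr => (hx.2.2 r).2 ⟨hr.1, hM.1 hr.2⟩
    have hcf : ConflictFree R := fun r hr t ht hne => (immConc_iff _ _).2
      ⟨hr.1.trans ht.1.symm, hM.2.1 _ hr.2 _ ht.2 fun h => hne (tr_ext (hr.1.trans ht.1.symm) h)⟩
    have hex : ∀ e ∈ M, ∃ r ∈ R, ev r = e := by
      intro e he
      obtain ⟨C', hC'⟩ := hx.2.1 e (hM.1 he)
      obtain ⟨r, hr, rfl, _⟩ := exists_tr hC'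
      exact ⟨r, ⟨hr, he⟩, rfl⟩
    have hmax : ¬ ∃ t ∈ p.1.1 \ R, ∀ t' ∈ R, ImmConc t t' := by
      rintro ⟨t, ⟨ht, htR⟩, h⟩
      obtain ⟨hs, ht⟩ := (hx.2.2 t).1 ht
      obtain ⟨e, he, hco⟩ := hM.2.2 _ ht fun h' => htR ⟨hs, h'⟩
      obtain ⟨r, hr, rfl⟩ := hex e he
      exact hco ((immConc_iff _ _).1 (h r hr)).2
    have hsupp : IsSupport R := by
      rcases R.eq_empty_or_nonempty with h | h
      · -- only the empty set has the empty set as a complete trace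
        have hp : p.1.1 = R := by
          refine Set.Subset.antisymm (fun t ht => ?_) hsub
          by_contra ht'
          exact hmax ⟨t, ⟨ht, ht'⟩, fun t' ht' => by simp [h] at ht'⟩
        rw [← hp]
        obtain ⟨s, hs | hs⟩ := p.1.2
        · exact Or.inl ⟨s, hs⟩
        · exact hs.1
      · exact Or.inr ⟨h, hcf⟩
    have htr : CompleteTrace R p.1.1 := ⟨hsupp, hcf, hsub, hmax⟩
    have hmem : R ∈ E.toSystem.maximalSets := by
      obtain ⟨s, hs | hs⟩ := p.1.2
      · exact ⟨s, Or.inr (hs ▸ htr)⟩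
      · -- a complete trace has no other complete trace than itself
        refine ⟨s, Or.inr ?_⟩
        have hp : p.1.1 = R := by
          refine Set.Subset.antisymm (fun t ht => ?_) hsub
          by_contra ht'
          exact hmax ⟨t, ⟨ht, ht'⟩, fun t' h' => hs.2.1 t ht t' (hsub h') fun h =>
            ht' (h ▸ h')⟩
        exact hp ▸ hs
    exact ⟨(⟨R, hmem⟩, p.2), Or.inr ⟨rfl, htr, rfl⟩, hx.1, fun e he => hx.2.1 e (hM.1 he),
      fun r => Iff.rfl⟩

/-- Processes and positions satisfy the same specifications. -/
theorem initProc_mem_denote_iff (hfin : E.ImageFinite) {φ : TFL ℕ} (hφ : φ.IsSpec)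
    (V : ℕ → Set E.toSystem.Proc) (W : ℕ → Set E.Position) :
    E.toSystem.initProc ∈ E.toSystem.denote φ V ↔
      Position.initial hfin ∈ TFL.den (Position.Rel hfin) φ W := by
  rw [denote_eq_den]
  exact TFL.mem_den_iff_of_bisim Describes (fun _ _ _ => Describes.unique)
    (fun l p q x => Describes.zig l p q x) (fun l p x y => Describes.zag l p x y) φ hφ.1 V W
    (by simp [hφ.2]) _ _ describes_initProc

end EventStructure

/-! ### Bisimilarity of positions, and covering sets -/

namespace EventStructure

variable {α : Type u} {E : EventStructure α ℕ} {C C' D D' : E.Config} {e : α}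

theorem FutIso.futureIso {g : α → α} (hg : FutIso g C D) : FutureIso C D :=
  ⟨hg.bijOn.equiv g, fun x y => hg.le_iff x x.2 y y.2, fun x y => hg.conflict_iff x x.2 y y.2,
    fun x => hg.label_eq x x.2⟩

/-- A set of pairwise concurrent events is its only trace. -/
theorem IsTrace.eq_of_isTrace {P M N : Finset α} (hM : E.IsTrace P M) (hN : E.IsTrace M N) :
    N = M := by
  refine Finset.Subset.antisymm hN.1 fun e he => ?_
  by_contra h
  obtain ⟨e', he', hco⟩ := hN.2.2 e he h
  exact hco (hM.2.1 e he e' (hN.1 he') fun h' => h (h' ▸ he'))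

open Classical in
theorem FutIso.isTrace_image_iff {g : α → α} (hg : FutIso g C D) {P M : Finset α}
    (hP : ∀ e ∈ P, e ∈ future C) (hM : M ⊆ P) :
    E.IsTrace (P.image g) (M.image g) ↔ E.IsTrace P M := by
  have hco : ∀ e ∈ P, ∀ e' ∈ P, (E.co (g e) (g e') ↔ E.co e e') :=
    fun e he e' he' => hg.co_iff (hP e he) (hP e' he')
  have hinj : ∀ e ∈ P, ∀ e' ∈ P, g e = g e' → e = e' :=
    fun e he e' he' h => hg.bijOn.injOn (hP e he) (hP e' he') h
  have hmem : ∀ e ∈ P, (g e ∈ M.image g ↔ e ∈ M) := by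
    refine fun e he => ⟨fun h => ?_, Finset.mem_image_of_mem g⟩
    obtain ⟨e', he', h⟩ := Finset.mem_image.1 h
    exact hinj e' (hM he') e he h ▸ he'
  constructor
  · rintro ⟨_, h₂, h₃⟩
    refine ⟨hM, fun e he e' he' hne => ?_, fun e he he' => ?_⟩
    · exact (hco e (hM he) e' (hM he')).1 (h₂ _ (Finset.mem_image_of_mem g he) _
        (Finset.mem_image_of_mem g he') fun h => hne (hinj e (hM he) e' (hM he') h))
    · obtain ⟨_, hgd, h⟩ := h₃ _ (Finset.mem_image_of_mem g he) fun h => he' ((hmem e he).1 h)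
      obtain ⟨d, hd, rfl⟩ := Finset.mem_image.1 hgd
      exact ⟨d, hd, fun h' => h ((hco e he d (hM hd)).2 h')⟩
  · rintro ⟨_, h₂, h₃⟩
    refine ⟨Finset.image_subset_image hM, ?_, ?_⟩
    · simp only [Finset.forall_mem_image]
      exact fun e he e' he' hne =>
        (hco e (hM he) e' (hM he')).2 (h₂ e he e' he' fun h => hne (h ▸ rfl))
    · simp only [Finset.forall_mem_image]
      intro e he he'
      obtain ⟨d, hd, h⟩ := h₃ e he fun h => he' ((hmem e he).2 h)
      exact ⟨g d, Finset.mem_image_of_mem g hd, fun h' => h ((hco e he d (hM hd)).1 h')⟩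

namespace Position

variable {hfin : E.ImageFinite}

open Classical in
/-- Two positions match if there is an isomorphism of the futures of their configurations that
respects the support sets and the modalities of the events that can occur. -/
def Matches (p q : E.Position) : Prop :=
  ∃ g, FutIso g p.config q.config ∧ p.Valid ∧ q.supp = p.supp.image g ∧
    ∀ e, Enabled p.config e → (g e ∈ q.past ↔ e ∈ p.past)

theorem matches_after {g : α → α} {p q : E.Position} (hg : FutIso g p.config q.config)
    (h : Step p.config e C') (h' : Step q.config (g e) D') :
    Matches (p.after hfin C') (q.after hfin D') := by
  have hg' := hg.step h h'
  refine ⟨g, hg', valid_after _ _, ?_, fun x hx => ?_⟩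
  · ext d
    rw [after, mem_enabledSet, hg'.enabled_iff_exists]
    simp [after]
  · simp only [after, mem_enabledSet]
    exact hg.enabled_iff_enabled ((h.mem_future_iff x).1 hx.mem_future).1

theorem modality_eq {g : α → α} {p q : E.Position} (hg : FutIso g p.config q.config)
    (hpast : ∀ e, Enabled p.config e → (g e ∈ q.past ↔ e ∈ p.past)) (he : Enabled p.config e) :
    q.modality (g e) = p.modality e := by
  have h := hpast e he
  by_cases h' : e ∈ p.past <;> simp [modality, hg.label_eq e he.mem_future, h, h']

theorem Matches.zig (l : ℕ) (p p' q : E.Position) (h : Matches p q) (hp : Rel hfin l p p') :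
    ∃ q', Rel hfin l q q' ∧ Matches p' q' := by
  classical
  obtain ⟨g, hg, hv, hsupp, hpast⟩ := h
  rcases hp with ⟨e, C', he, hC', rfl, rfl⟩ | ⟨rfl, M, hM, rfl⟩
  · obtain ⟨D', hD'⟩ := (hg.enabled_iff_enabled (hv e he).mem_future).2 (hv e he)
    exact ⟨q.after hfin D', Or.inl ⟨g e, D', hsupp ▸ Finset.mem_image_of_mem g he, hD',
      (modality_eq hg hpast (hv e he)).symm, rfl⟩, matches_after hg hC' hD'⟩
  · refine ⟨⟨q.config, q.past, M.image g⟩, Or.inr ⟨rfl, _, ?_, rfl⟩, g, hg,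
      fun e he => hv e (hM.1 he), by congr!, hpast⟩
    rw [hsupp]
    convert (hg.isTrace_image_iff (fun e he => (hv e he).mem_future) hM.1).2 hM

theorem Matches.zag (l : ℕ) (p q q' : E.Position) (h : Matches p q) (hq : Rel hfin l q q') :
    ∃ p', Rel hfin l p p' ∧ Matches p' q' := by
  classical
  obtain ⟨g, hg, hv, hsupp, hpast⟩ := h
  rcases hq with ⟨d, D', hd, hD', rfl, rfl⟩ | ⟨rfl, N, hN, rfl⟩
  · rw [hsupp] at hd
    obtain ⟨e, he, rfl⟩ := Finset.mem_image.1 hd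
    obtain ⟨C', hC'⟩ := hv e he
    exact ⟨p.after hfin C', Or.inl ⟨e, C', he, hC', modality_eq hg hpast (hv e he), rfl⟩,
      matches_after hg hC' hD'⟩
  · rw [hsupp] at hN
    obtain ⟨M, hM, rfl⟩ : ∃ M ⊆ p.supp, N = M.image g := by
      obtain ⟨M, hM, h⟩ := Finset.subset_image_iff.1 hN.1
      exact ⟨M, hM, h.symm⟩
    refine ⟨⟨p.config, p.past, M⟩, Or.inr ⟨rfl, M, ?_, rfl⟩, g, hg,
      fun e he => hv e (hM he), by congr!, hpast⟩
    refine (hg.isTrace_image_iff (fun e he => (hv e he).mem_future) hM).1 ?_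
    convert hN

theorem Matches.typ_eq {p q : E.Position} (h : Matches p q)
    (hp : p ∈ LTS.Reach (Rel hfin) (initial hfin)) (hq : q ∈ LTS.Reach (Rel hfin) (initial hfin))
    (n : ℕ) : LTS.typ (Rel hfin) n p = LTS.typ (Rel hfin) n q :=
  LTS.typ_eq_of_bisim finBranching (fun _ _ _ => LTS.reach_of_rel) Matches
    (fun l p p' q => Matches.zig l p p' q) (fun l p q q' => Matches.zag l p q q') n p hp q hq h

end Position

/-- A non-empty configuration arises by the occurrence of one of its maximal events. -/
theorem Config.exists_step (C : E.Config) (hC : C.events.Nonempty) :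
    ∃ C₀ e, Step C₀ e C ∧ C.events.card = C₀.events.card + 1 := by
  classical
  let _ : PartialOrder α :=
    { le := E.le, le_refl := E.le_refl, le_trans := E.le_trans, le_antisymm := E.le_antisymm }
  obtain ⟨e, he⟩ := C.events.exists_maximal hC
  refine ⟨⟨C.events.erase e, ?_, ?_⟩, e, ⟨by simp, fun x => ?_⟩, ?_⟩
  · exact fun x hx y hy => C.conflict_free x (Finset.mem_of_mem_erase hx) y
      (Finset.mem_of_mem_erase hy)
  · intro x hx y hyx
    obtain ⟨hne, hxC⟩ := Finset.mem_erase.1 hx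
    refine Finset.mem_erase.2 ⟨?_, C.down_closed x hxC y hyx⟩
    rintro rfl
    exact hne (E.le_antisymm _ _ (he.2 hxC hyx) hyx)
  · by_cases h : x = e
    · simp [h, he.1]
    · simp [h]
  · exact (Finset.card_erase_add_one he.1).symm

theorem Step.card_eq (h : Step C e C') : C'.events.card = C.events.card + 1 := by
  rw [h.events_eq_cons, Finset.card_cons]

namespace Position

variable {hfin : E.ImageFinite}

variable (hfin) in
/-- The positions at distance at most `j` from the initial one. -/
abbrev level (j : ℕ) : Set E.Position := LTS.level (Rel hfin) (initial hfin) j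

theorem card_le_of_mem_level {j : ℕ} {p : E.Position} (hp : p ∈ level hfin j) :
    p.config.events.card ≤ j := by
  induction j generalizing p with
  | zero => rw [Set.mem_singleton_iff.1 hp]; simp [initial, Config.empty]
  | succ j ih =>
    rcases hp with hp | ⟨q, hq, l, h⟩
    · exact (ih hp).trans (Nat.le_succ j)
    · rcases h with ⟨e, C', _, hC', _, rfl⟩ | ⟨_, M, _, rfl⟩
      · have := ih hq
        have := hC'.card_eq
        simp only [after]
        omega
      · exact (ih hq).trans (Nat.le_succ j)

theorem exists_mem_level (C : E.Config) :
    ∃ N, ⟨C, N, enabledSet hfin C⟩ ∈ level hfin C.events.card := by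
  induction h : C.events.card generalizing C with
  | zero =>
    rw [Finset.card_eq_zero] at h
    obtain rfl : C = Config.empty E := Config.ext_events fun x => by simp [h, Config.empty]
    exact ⟨_, rfl⟩
  | succ n ih =>
    obtain ⟨C₀, e, hC, hcard⟩ := C.exists_step (Finset.card_pos.1 (by omega))
    obtain ⟨N, hN⟩ := ih C₀ (by omega)
    exact ⟨_, LTS.level_succ_of_rel hN (Or.inl ⟨e, C, mem_enabledSet.2 ⟨C, hC⟩, hC, rfl, rfl⟩)⟩

theorem mem_level_of_step (h : Step C e C') :
    ⟨C', enabledSet hfin C, enabledSet hfin C'⟩ ∈ level hfin (C.events.card + 1) := by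
  obtain ⟨N, hN⟩ := exists_mem_level (hfin := hfin) C
  exact LTS.level_succ_of_rel hN (Or.inl ⟨e, C', mem_enabledSet.2 ⟨C', h⟩, h, rfl, rfl⟩)

/-- The shape of the positions that can be reached: the last transition is an arbitrary one, and
the support set is the set of all events that can occur, or a trace of it. -/
theorem shape_of_reach : ∀ p ∈ LTS.Reach (Rel hfin) (initial hfin),
    ((p.config = Config.empty E ∧ p.past = ∅) ∨
      ∃ C₀ e, Step C₀ e p.config ∧ p.past = enabledSet hfin C₀) ∧
    (p.supp = enabledSet hfin p.config ∨ E.IsTrace (enabledSet hfin p.config) p.supp) := by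
  refine LTS.reach_induction ⟨Or.inl ⟨rfl, rfl⟩, Or.inl rfl⟩ ?_
  rintro l p q ⟨h₁, h₂⟩ (⟨e, C', _, hC', _, rfl⟩ | ⟨_, M, hM, rfl⟩)
  · exact ⟨Or.inr ⟨_, e, hC', rfl⟩, Or.inl rfl⟩
  · refine ⟨h₁, Or.inr ?_⟩
    rcases h₂ with h₂ | h₂
    · exact h₂ ▸ hM
    · rw [h₂.eq_of_isTrace hM]
      exact h₂

/-- If the configurations at distance `j + 1` have no other futures than those at distance at most
`j`, then all futures occur at distance at most `j`. -/
theorem exists_futureIso_card_le {j : ℕ}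
    (hcov : ∀ p ∈ level hfin (j + 1), ∃ q ∈ level hfin j, FutureIso p.config q.config)
    (C : E.Config) : ∃ D : E.Config, D.events.card ≤ j ∧ FutureIso C D := by
  induction h : C.events.card generalizing C with
  | zero => exact ⟨C, by omega, E.futureSetoid.refl C⟩
  | succ n ih =>
    obtain ⟨C₀, e, hC, hcard⟩ := C.exists_step (Finset.card_pos.1 (by omega))
    obtain ⟨D₀, hD₀, hiso⟩ := ih C₀ (by omega)
    obtain ⟨g, hg⟩ := hiso.exists_futIso
    obtain ⟨D, hD⟩ := (hg.enabled_iff_exists (g e)).2 ⟨e, ⟨C, hC⟩, rfl⟩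
    obtain ⟨q, hq, hiso'⟩ :=
      hcov _ (LTS.level_mono (Nat.succ_le_succ hD₀) (mem_level_of_step (hfin := hfin) hD))
    exact ⟨q.config, card_le_of_mem_level hq,
      E.futureSetoid.trans (hg.step hC hD).futureIso hiso'⟩

/-- If the configurations at distance `j + 1` have no other futures than those at distance at most
`j`, then the positions at distance at most `j + 2` represent all positions: beyond the
distance `j`, one step is the last transition, and one more narrows the support set. -/
theorem covers_level {j : ℕ}
    (hcov : ∀ p ∈ level hfin (j + 1), ∃ q ∈ level hfin j, FutureIso p.config q.config) :
    LTS.Covers (Rel hfin) (initial hfin) (level hfin (j + 2)) := by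
  refine ⟨LTS.level_subset_reach _, fun p hp => ?_⟩
  obtain ⟨h₁, h₂⟩ := shape_of_reach p hp
  rcases h₁ with ⟨hc, hpast⟩ | ⟨C₀, e, hC, hpast⟩
  · refine ⟨p, LTS.level_mono (show 1 ≤ j + 2 by omega) ?_, fun _ => rfl⟩
    rcases h₂ with h₂ | h₂
    · exact Or.inl (Position.ext hc hpast (by rw [h₂, hc]; rfl))
    · refine LTS.level_succ_of_rel rfl (Or.inr ⟨rfl, p.supp, ?_, Position.ext hc hpast rfl⟩)
      rw [hc] at h₂
      exact h₂
  · obtain ⟨D₀, hD₀, hiso⟩ := exists_futureIso_card_le hcov C₀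
    obtain ⟨g, hg⟩ := hiso.exists_futIso
    obtain ⟨D, hD⟩ := (hg.enabled_iff_exists (g e)).2 ⟨e, ⟨_, hC⟩, rfl⟩
    have hq : ⟨D, enabledSet hfin D₀, enabledSet hfin D⟩ ∈ level hfin (j + 1) :=
      LTS.level_mono (Nat.succ_le_succ hD₀) (mem_level_of_step hD)
    have hmatch : Matches ⟨p.config, p.past, enabledSet hfin p.config⟩
        ⟨D, enabledSet hfin D₀, enabledSet hfin D⟩ := by
      rw [hpast]
      exact matches_after (p := ⟨C₀, ∅, ∅⟩) (q := ⟨D₀, ∅, ∅⟩) hg hC hD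
    rcases h₂ with h₂ | h₂
    · have hq' := LTS.level_mono (Nat.le_succ (j + 1)) hq
      refine ⟨_, hq', Matches.typ_eq ?_ hp ⟨_, hq'⟩⟩
      rwa [← h₂] at hmatch
    · obtain ⟨q, hq', hm⟩ := hmatch.zig (hfin := hfin) 2 _ p _ (Or.inr ⟨rfl, p.supp, h₂, rfl⟩)
      have hq'' := LTS.level_succ_of_rel hq hq'
      exact ⟨q, hq'', hm.typ_eq hp ⟨_, hq''⟩⟩

/-- Regularity provides a distance at which the futures are exhausted and the approximations of
bisimilarity have become stable. -/
theorem exists_exhaustive {sim : Setoid E.Config} (hsim : E.IsRegularQuotient sim) :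
    ∃ j, (∀ p ∈ level hfin (j + 1), ∃ q ∈ level hfin j, sim p.config q.config) ∧
      LTS.Stable (Rel hfin) (level hfin (j + 2)) j := by
  have := hsim.finiteIndex
  let a : ℕ →o Set (Quotient sim) :=
    ⟨fun j => (fun p : E.Position => Quotient.mk sim p.config) '' level hfin j,
      fun i j h => Set.image_mono (LTS.level_mono h)⟩
  obtain ⟨j₀, h₀⟩ := WellFoundedGT.monotone_chain_condition a
  have hcov : ∀ j, j₀ ≤ j →
      ∀ p ∈ level hfin (j + 1), ∃ q ∈ level hfin j, sim p.config q.config := by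
    intro j hj p hp
    have hmem : Quotient.mk sim p.config ∈ a (j + 1) := ⟨p, hp, rfl⟩
    rw [← h₀ (j + 1) (by omega), h₀ j hj] at hmem
    obtain ⟨q, hq, h⟩ := hmem
    exact ⟨q, hq, sim.symm (Quotient.exact h)⟩
  have hL : LTS.Covers (Rel hfin) (initial hfin) (level hfin (j₀ + 2)) := by
    refine covers_level fun p hp => ?_
    obtain ⟨q, hq, h⟩ := hcov j₀ le_rfl p hp
    exact ⟨q, hq, hsim.futureIso _ _ h⟩
  obtain ⟨n₀, h₁⟩ := LTS.eventually_stable finBranching hL.1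
    (LTS.level_finite finBranching (j₀ + 2))
  exact ⟨max j₀ n₀, hcov _ (le_max_left _ _),
    (h₁ _ (le_max_right _ _)).of_covers hL (LTS.level_subset_reach _)⟩

end Position

/-- The finite system `K` is the quotient of the positions at distance at most `j + 2` by the
`j`-th approximation of bisimilarity. -/
def IsQuotientSystem (hfin : E.ImageFinite) (j : ℕ) (K : FinSys) : Prop :=
  (∀ k, k ∈ K.1 ↔ k = LTS.typ (Position.Rel hfin) j (Position.initial hfin) ∨
    ∃ p ∈ Position.level hfin (j + 2), ∃ l q, Position.Rel hfin l p q ∧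
      k = LTS.typ (Position.Rel hfin) j q) ∧
  ∀ t, t ∈ K.2 ↔ ∃ p ∈ Position.level hfin (j + 2), ∃ l q, Position.Rel hfin l p q ∧
    t = (LTS.typ (Position.Rel hfin) j p, l, LTS.typ (Position.Rel hfin) j q)

/-- The quotient system satisfies the same specifications as the event structure. -/
theorem IsQuotientSystem.initProc_mem_denote_iff {hfin : E.ImageFinite} {j : ℕ} {K : FinSys}
    (hK : IsQuotientSystem hfin j K)
    (hcov : ∀ p ∈ Position.level hfin (j + 1), ∃ q ∈ Position.level hfin j,
      FutureIso p.config q.config)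
    (hst : LTS.Stable (Position.Rel hfin) (Position.level hfin (j + 2)) j)
    {φ : TFL ℕ} (hφ : φ.IsSpec) (V : ℕ → Set E.toSystem.Proc) (W : ℕ → Set K.Point) :
    E.toSystem.initProc ∈ E.toSystem.denote φ V ↔
      ⟨LTS.typ (Position.Rel hfin) j (Position.initial hfin), (hK.1 _).2 (Or.inl rfl)⟩ ∈
        TFL.den K.Rel φ W := by
  rw [EventStructure.initProc_mem_denote_iff hfin hφ V fun _ => ∅]
  refine LTS.mem_den_iff_quotient Position.finBranching (Position.covers_level hcov) hst hK.1 ?_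
    hφ _ W
  intro l k k'
  rw [FinSys.Rel, hK.2]
  constructor
  · rintro ⟨p, hp, l', q, hq, h⟩
    obtain ⟨h₁, rfl, h₂⟩ := by simpa only [Prod.mk.injEq] using h
    exact ⟨p, hp, q, hq, h₁, h₂⟩
  · rintro ⟨p, hp, q, hq, h₁, h₂⟩
    exact ⟨p, hp, l, q, hq, by rw [h₁, h₂]⟩

theorem IsQuotientSystem.target_mem {hfin : E.ImageFinite} {j : ℕ} {K : FinSys}
    (hK : IsQuotientSystem hfin j K) : ∀ t ∈ K.2, t.2.2 ∈ K.1 := by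
  intro t ht
  obtain ⟨p, hp, l, q, hq, rfl⟩ := (hK.2 t).1 ht
  exact (hK.1 _).2 (Or.inr ⟨p, hp, l, q, hq, rfl⟩)

theorem exists_isQuotientSystem (hfin : E.ImageFinite) (j : ℕ) :
    ∃ K, IsQuotientSystem hfin j K := by
  have hf : {x : E.Position × ℕ × E.Position | x.1 ∈ Position.level hfin (j + 2) ∧
      Position.Rel hfin x.2.1 x.1 x.2.2}.Finite := by
    have hL : (Position.level hfin (j + 2)).Finite := LTS.level_finite Position.finBranching (j + 2)
    refine (hL.biUnion
      (t := fun p => Prod.mk p '' {y : ℕ × E.Position | Position.Rel hfin y.1 p y.2})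
      fun p hp => (Position.finBranching (I := Position.level hfin (j + 2)) p hp).image _).subset ?_
    rintro ⟨p, l, q⟩ ⟨hp, h⟩
    exact Set.mem_biUnion hp ⟨(l, q), h, rfl⟩
  let T := LTS.typ (Position.Rel hfin) j
  refine ⟨(T (Position.initial hfin) :: hf.toFinset.toList.map fun x => T x.2.2,
    hf.toFinset.toList.map fun x => (T x.1, x.2.1, T x.2.2)), fun k => ?_, fun t => ?_⟩
  · simp only [List.mem_cons, List.mem_map, Finset.mem_toList, Set.Finite.mem_toFinset,
      Set.mem_ofPred_eq]
    refine or_congr_right ⟨?_, ?_⟩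
    · rintro ⟨⟨p, l, q⟩, ⟨hp, h⟩, rfl⟩
      exact ⟨p, hp, l, q, h, rfl⟩
    · rintro ⟨p, hp, l, q, h, rfl⟩
      exact ⟨⟨p, l, q⟩, ⟨hp, h⟩, rfl⟩
  · simp only [List.mem_map, Finset.mem_toList, Set.Finite.mem_toFinset, Set.mem_ofPred_eq]
    constructor
    · rintro ⟨⟨p, l, q⟩, ⟨hp, h⟩, rfl⟩
      exact ⟨p, hp, l, q, h, rfl⟩
    · rintro ⟨p, hp, l, q, h, rfl⟩
      exact ⟨⟨p, l, q⟩, ⟨hp, h⟩, rfl⟩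

/-- Every regular event structure has a decidable theory. -/
theorem IsRegular.exists_computable (hE : E.IsRegular) :
    ∃ d : ℕ → Bool, Computable d ∧ ∀ φ : TFL ℕ, φ.IsSpec → ∀ V : ℕ → Set E.toSystem.Proc,
      d φ.code = true ↔ E.toSystem.initProc ∈ E.toSystem.denote φ V := by
  obtain ⟨mc, hmc, hspec⟩ := FinSys.exists_modelChecker
  obtain ⟨j, hcov, hst⟩ := Position.exists_exhaustive (hfin := hE.imageFinite)
    (sim := E.futureSetoid) ⟨hE.finiteIndex, fun _ _ h => h⟩
  obtain ⟨K, hK⟩ := exists_isQuotientSystem hE.imageFinite j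
  refine ⟨fun n => mc (K, LTS.typ (Position.Rel hE.imageFinite) j
    (Position.initial hE.imageFinite), n), hmc.comp ((Computable.const _).pair
      ((Computable.const _).pair Computable.id)), fun φ hφ V => ?_⟩
  obtain ⟨W, hW⟩ := hspec K ⟨_, (hK.1 _).2 (Or.inl rfl)⟩ hK.target_mem φ hφ.1
  rw [hK.initProc_mem_denote_iff hcov hst hφ V W]
  exact hW

end EventStructure

/-! ### Exploring a presented event structure -/

/-- The elements of the finite set with canonical index `n`. -/
def bits (n : ℕ) : List ℕ := (List.range n).filter fun e => n.testBit e

theorem mem_bits {n e : ℕ} : e ∈ bits n ↔ n.testBit e = true := by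
  simp only [bits, List.mem_filter, List.mem_range, and_iff_right_iff_imp]
  exact fun h => Nat.lt_two_pow_self.trans_le (Nat.ge_two_pow_of_testBit h)

/-- A position in terms of canonical indices. -/
abbrev Node : Type := ℕ × ℕ × ℕ

namespace Node

variable (nx lb : ℕ → ℕ)

/-- The set with index `m'` is a maximal set of pairwise concurrent events in the set with index
`m` at the configuration with index `x`, if `nx` computes the sets of enabled events. -/
def IsTraceIndex (x m m' : ℕ) : Prop :=
  (∀ e ∈ bits m', e ∈ bits m) ∧
  (∀ e ∈ bits m', ∀ e' ∈ bits m', e = e' ∨ e' ∈ bits (nx (x + 2 ^ e))) ∧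
  ∀ e ∈ bits m, e ∈ bits m' ∨ ∃ e' ∈ bits m', e ∉ bits (nx (x + 2 ^ e'))

instance (x m m' : ℕ) : Decidable (IsTraceIndex nx x m m') := by
  unfold IsTraceIndex; infer_instance

/-- The transitions from a node, if `nx` computes the sets of enabled events and `lb` the labels
of events. -/
def succ (p : Node) : List (ℕ × Node) :=
  ((bits p.2.2).map fun e => (3 * lb e + (if e ∈ bits p.2.1 then 1 else 0),
    (p.1 + 2 ^ e, nx p.1, nx (p.1 + 2 ^ e)))) ++
  ((List.range (p.2.2 + 1)).filter fun m' => IsTraceIndex nx p.1 p.2.2 m').map fun m' =>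
    (2, (p.1, p.2.1, m'))

/-- The initial node. -/
def start : Node := (0, 0, nx 0)

/-- The nodes at distance at most `j` from the initial one. -/
def upTo : ℕ → List Node
  | 0 => [start nx]
  | j + 1 => upTo j ++ (upTo j).flatMap fun p => (succ nx lb p).map Prod.snd

/-- The approximations of the bisimilarity class of a node. -/
def tau : ℕ → Node → ℕ
  | 0, _ => 0
  | n + 1, p => setCode ((succ nx lb p).map fun c => Nat.pair c.1 (tau n c.2)).toFinset

/-- The quotient system that is obtained from the nodes at distance at most `j + 2`. -/
def quotient (j : ℕ) : FinSys :=
  (tau nx lb j (start nx) ::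
    (upTo nx lb (j + 2)).flatMap fun p => (succ nx lb p).map fun c => tau nx lb j c.2,
   (upTo nx lb (j + 2)).flatMap fun p => (succ nx lb p).map fun c =>
    (tau nx lb j p, c.1, tau nx lb j c.2))

end Node

namespace EventStructure

variable {α : Type u} {E : EventStructure α ℕ} {num : α → ℕ} {hfin : E.ImageFinite}

theorem testBit_canonicalIndex (hnum : Function.Injective num) (F : Finset α) (c : ℕ) :
    (canonicalIndex num F).testBit c = true ↔ ∃ e ∈ F, num e = c := by
  have : canonicalIndex num F = setCode (F.map ⟨num, hnum⟩) := by
    simp [canonicalIndex, setCode]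
  rw [this, testBit_setCode]
  simp

theorem mem_bits_canonicalIndex (hnum : Function.Injective num) (F : Finset α) (c : ℕ) :
    c ∈ bits (canonicalIndex num F) ↔ ∃ e ∈ F, num e = c := by
  rw [mem_bits, testBit_canonicalIndex hnum]

theorem num_mem_bits (hnum : Function.Injective num) {F : Finset α} {e : α} :
    num e ∈ bits (canonicalIndex num F) ↔ e ∈ F := by
  rw [mem_bits_canonicalIndex hnum]
  exact ⟨fun ⟨d, hd, h⟩ => hnum h ▸ hd, fun h => ⟨e, h, rfl⟩⟩

theorem forall_mem_bits (hnum : Function.Injective num) {F : Finset α} {P : ℕ → Prop} :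
    (∀ c ∈ bits (canonicalIndex num F), P c) ↔ ∀ e ∈ F, P (num e) := by
  simp only [mem_bits_canonicalIndex hnum]
  exact ⟨fun h e he => h _ ⟨e, he, rfl⟩, fun h c ⟨e, he, hc⟩ => hc ▸ h e he⟩

theorem exists_mem_bits (hnum : Function.Injective num) {F : Finset α} {P : ℕ → Prop} :
    (∃ c ∈ bits (canonicalIndex num F), P c) ↔ ∃ e ∈ F, P (num e) := by
  simp only [mem_bits_canonicalIndex hnum]
  exact ⟨fun ⟨c, ⟨e, he, hc⟩, h⟩ => ⟨e, he, hc ▸ h⟩, fun ⟨e, he, h⟩ => ⟨_, ⟨e, he, rfl⟩, h⟩⟩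

theorem Step.canonicalIndex_eq {C C' : E.Config} {e : α} (h : Step C e C') :
    canonicalIndex num C'.events = canonicalIndex num C.events + 2 ^ num e := by
  rw [h.events_eq_cons, canonicalIndex, Finset.sum_cons, add_comm]
  rfl

theorem co_comm (e e' : α) : E.co e e' ↔ E.co e' e := by
  have h : ∀ e e' : α, E.conflict e e' → E.conflict e' e := E.conflict_symm
  exact ⟨fun ⟨h₁, h₂, h₃⟩ => ⟨h₂, h₁, fun hc => h₃ (h _ _ hc)⟩,
    fun ⟨h₁, h₂, h₃⟩ => ⟨h₂, h₁, fun hc => h₃ (h _ _ hc)⟩⟩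

namespace Position

/-- The node that represents a position. -/
def node (num : α → ℕ) (p : E.Position) : Node :=
  (canonicalIndex num p.config.events, canonicalIndex num p.past, canonicalIndex num p.supp)

/-- The functions `nx` and `lb` give correct answers at the position `p` and its successors. -/
def Correct (hfin : E.ImageFinite) (num : α → ℕ) (nx lb : ℕ → ℕ) (p : E.Position) : Prop :=
  nx (canonicalIndex num p.config.events) = canonicalIndex num (enabledSet hfin p.config) ∧
  ∀ e ∈ p.supp, lb (num e) = E.label e ∧ ∀ C', Step p.config e C' →
    nx (canonicalIndex num C'.events) = canonicalIndex num (enabledSet hfin C')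

variable {nx lb : ℕ → ℕ} {p : E.Position}

theorem isTraceIndex_iff (hnum : Function.Injective num) (hp : p.Valid)
    (hc : Correct hfin num nx lb p) {M : Finset α} (hM : M ⊆ p.supp) :
    Node.IsTraceIndex nx (canonicalIndex num p.config.events) (canonicalIndex num p.supp)
      (canonicalIndex num M) ↔ E.IsTrace p.supp M := by
  have hco : ∀ e ∈ p.supp, ∀ e' ∈ p.supp, e ≠ e' →
      (num e' ∈ bits (nx (canonicalIndex num p.config.events + 2 ^ num e)) ↔ E.co e e') := by
    intro e he e' he' hne
    obtain ⟨C', hC'⟩ := hp e he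
    rw [← hC'.canonicalIndex_eq, (hc.2 e he).2 C' hC', num_mem_bits hnum, mem_enabledSet,
      hC'.co_iff_enabled (hp e' he') hne]
  simp only [Node.IsTraceIndex, forall_mem_bits hnum, exists_mem_bits hnum, num_mem_bits hnum,
    hnum.eq_iff, IsTrace]
  refine and_congr Iff.rfl (and_congr ?_ ?_)
  · refine forall₂_congr fun e he => forall₂_congr fun e' he' => ?_
    by_cases h : e = e'
    · simp [h]
    · simp [h, hco e (hM he) e' (hM he') h]
  · refine forall₂_congr fun e he => ?_
    by_cases h : e ∈ M
    · simp [h]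
    · simp only [h, false_or, not_false_eq_true, true_imp_iff]
      refine exists_congr fun e' => and_congr_right fun he' => not_congr ?_
      rw [hco e' (hM he') e he (fun h' => h (h' ▸ he')), co_comm]

/-- At positions where `nx` and `lb` are correct, `Node.succ` computes the transitions. -/
theorem mem_succ_iff (hnum : Function.Injective num) (hp : p.Valid)
    (hc : Correct hfin num nx lb p) (l : ℕ) (y : Node) :
    (l, y) ∈ Node.succ nx lb (p.node num) ↔ ∃ q, Rel hfin l p q ∧ y = q.node num := by
  classical
  have hev : ∀ e ∈ p.supp, ∀ C', Step p.config e C' →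
      (3 * lb (num e) + (if num e ∈ bits (canonicalIndex num p.past) then 1 else 0),
        (canonicalIndex num p.config.events + 2 ^ num e, nx (canonicalIndex num p.config.events),
          nx (canonicalIndex num p.config.events + 2 ^ num e))) =
      (p.modality e, (p.after hfin C').node num) := by
    intro e he C' hC'
    have h : (if num e ∈ bits (canonicalIndex num p.past) then 1 else 0) =
        if e ∈ p.past then 1 else 0 := by simp only [num_mem_bits hnum]
    rw [← hC'.canonicalIndex_eq, (hc.2 e he).1, (hc.2 e he).2 C' hC', hc.1, h]
    simp [modality, node, after]
  simp only [Node.succ, node, List.mem_append, List.mem_map, List.mem_filter, List.mem_range]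
  constructor
  · rintro (⟨c, hcm, h⟩ | ⟨m, ⟨_, hm⟩, h⟩)
    · obtain ⟨e, he, rfl⟩ := (mem_bits_canonicalIndex hnum _ _).1 hcm
      obtain ⟨C', hC'⟩ := hp e he
      obtain ⟨rfl, rfl⟩ := Prod.mk.inj ((hev e he C' hC').symm.trans h)
      exact ⟨p.after hfin C', Or.inl ⟨e, C', he, hC', rfl, rfl⟩, rfl⟩
    · obtain ⟨rfl, rfl⟩ := Prod.mk.inj h
      replace hm := of_decide_eq_true hm
      -- an index of a set of numbers of events in the support is the index of a set of events
      obtain ⟨M, hM, rfl⟩ : ∃ M ⊆ p.supp, canonicalIndex num M = m := by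
        refine ⟨p.supp.filter fun e => num e ∈ bits m, Finset.filter_subset _ _, ?_⟩
        refine Nat.eq_of_testBit_eq fun c => Bool.eq_iff_iff.2 ?_
        rw [testBit_canonicalIndex hnum, ← mem_bits]
        constructor
        · rintro ⟨e, he, rfl⟩
          exact (Finset.mem_filter.1 he).2
        · intro hcm
          obtain ⟨e, he, rfl⟩ := (mem_bits_canonicalIndex hnum _ _).1 (hm.1 c hcm)
          exact ⟨e, Finset.mem_filter.2 ⟨he, hcm⟩, rfl⟩
      exact ⟨⟨p.config, p.past, M⟩,
        Or.inr ⟨rfl, M, (isTraceIndex_iff hnum hp hc hM).1 hm, rfl⟩, rfl⟩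
  · rintro ⟨q, ⟨e, C', he, hC', rfl, rfl⟩ | ⟨rfl, M, hM, rfl⟩, rfl⟩
    · exact Or.inl ⟨num e, (num_mem_bits hnum).2 he, hev e he C' hC'⟩
    · refine Or.inr ⟨canonicalIndex num M,
        ⟨Nat.lt_succ_of_le ?_, decide_eq_true ((isTraceIndex_iff hnum hp hc hM.1).2 hM)⟩, rfl⟩
      exact Finset.sum_le_sum_of_subset hM.1

theorem node_initial (hc : Correct hfin num nx lb (initial hfin)) :
    (initial hfin).node num = Node.start nx := by
  have h := hc.1
  have h₀ : canonicalIndex num (Config.empty E).events = 0 := by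
    simp [canonicalIndex, Config.empty]
  have h₁ : canonicalIndex num (∅ : Finset α) = 0 := by simp [canonicalIndex]
  simp only [initial, h₀] at h
  simp only [node, initial, Node.start, h₀, h₁, h]

theorem valid_of_mem_level {j : ℕ} (hp : p ∈ level hfin j) : p.Valid :=
  valid_of_reach p ⟨j, hp⟩

/-- Correct answers at distance at most `J` suffice to compute the nodes up to distance `J + 1`. -/
theorem mem_upTo_iff (hnum : Function.Injective num) {J : ℕ}
    (hc : ∀ p ∈ level hfin J, Correct hfin num nx lb p) :
    ∀ i, i ≤ J + 1 → ∀ y, y ∈ Node.upTo nx lb i ↔ ∃ p ∈ level hfin i, y = p.node num := by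
  intro i
  induction i with
  | zero =>
    intro _ y
    have := node_initial (hc _ (LTS.level_mono (Nat.zero_le J) rfl))
    simp [Node.upTo, LTS.level, this]
  | succ i ih =>
    intro hi y
    have ih := ih (by omega)
    have hv : ∀ p ∈ level hfin i, ∀ l y,
        (l, y) ∈ Node.succ nx lb (p.node num) ↔ ∃ q, Rel hfin l p q ∧ y = q.node num :=
      fun p hp => mem_succ_iff hnum (valid_of_mem_level hp)
        (hc p (LTS.level_mono (by omega) hp))
    simp only [Node.upTo, List.mem_append, List.mem_flatMap, List.mem_map, ih]
    constructor
    · rintro (⟨p, hp, rfl⟩ | ⟨_, ⟨p, hp, rfl⟩, ⟨l, z⟩, hz, rfl⟩)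
      · exact ⟨p, Or.inl hp, rfl⟩
      · obtain ⟨q, hq, rfl⟩ := (hv p hp l z).1 hz
        exact ⟨q, LTS.level_succ_of_rel hp hq, rfl⟩
    · rintro ⟨q, hq | ⟨p, hp, l, hq⟩, rfl⟩
      · exact Or.inl ⟨q, hq, rfl⟩
      · exact Or.inr ⟨_, ⟨p, hp, rfl⟩, (l, q.node num), (hv p hp l _).2 ⟨q, hq, rfl⟩, rfl⟩

/-- The type of depth `n` of a position at distance `i` involves only the transitions that start at
distance less than `i + n`. -/
theorem tau_eq_typ (hnum : Function.Injective num) {J : ℕ}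
    (hc : ∀ p ∈ level hfin J, Correct hfin num nx lb p) (n : ℕ) :
    ∀ i, i + n ≤ J + 1 → ∀ p ∈ level hfin i,
      Node.tau nx lb n (p.node num) = LTS.typ (Rel hfin) n p := by
  induction n with
  | zero => intros; rfl
  | succ n ih =>
    intro i hi p hp
    rw [Node.tau, LTS.typ, dif_pos (LTS.typ_finite finBranching n (Set.mem_univ p))]
    congr 1
    ext c
    simp only [List.mem_toFinset, List.mem_map, Set.Finite.mem_toFinset, Set.mem_ofPred_eq]
    have hv := mem_succ_iff hnum (valid_of_mem_level hp) (hc p (LTS.level_mono (by omega) hp))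
    constructor
    · rintro ⟨⟨l, y⟩, hy, rfl⟩
      obtain ⟨q, hq, rfl⟩ := (hv l y).1 hy
      exact ⟨l, q, hq, by rw [ih (i + 1) (by omega) q (LTS.level_succ_of_rel hp hq)]⟩
    · rintro ⟨l, q, hq, rfl⟩
      exact ⟨(l, q.node num), (hv l _).2 ⟨q, hq, rfl⟩,
        by rw [ih (i + 1) (by omega) q (LTS.level_succ_of_rel hp hq)]⟩

theorem isQuotientSystem_quotient (hnum : Function.Injective num) {j : ℕ}
    (hc : ∀ p ∈ level hfin (2 * j + 2), Correct hfin num nx lb p) :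
    IsQuotientSystem hfin j (Node.quotient nx lb j) := by
  have hup := mem_upTo_iff hnum hc (j + 2) (by omega)
  have ht : ∀ p ∈ level hfin (j + 3), Node.tau nx lb j (p.node num) = LTS.typ (Rel hfin) j p :=
    tau_eq_typ hnum hc j (j + 3) (by omega)
  have hv : ∀ p ∈ level hfin (j + 2), ∀ l y,
      (l, y) ∈ Node.succ nx lb (p.node num) ↔ ∃ q, Rel hfin l p q ∧ y = q.node num :=
    fun p hp => mem_succ_iff hnum (valid_of_mem_level hp) (hc p (LTS.level_mono (by omega) hp))
  have hi : initial hfin ∈ level hfin (j + 3) := LTS.level_mono (Nat.zero_le _) rfl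
  constructor
  · intro k
    simp only [Node.quotient, List.mem_cons, List.mem_flatMap, List.mem_map, hup]
    rw [← node_initial (hc _ (LTS.level_mono (Nat.zero_le _) rfl)), ht _ hi]
    refine or_congr_right ⟨?_, ?_⟩
    · rintro ⟨_, ⟨p, hp, rfl⟩, ⟨l, y⟩, hy, rfl⟩
      obtain ⟨q, hq, rfl⟩ := (hv p hp l y).1 hy
      exact ⟨p, hp, l, q, hq, ht q (LTS.level_succ_of_rel hp hq)⟩
    · rintro ⟨p, hp, l, q, hq, rfl⟩
      exact ⟨_, ⟨p, hp, rfl⟩, (l, q.node num), (hv p hp l _).2 ⟨q, hq, rfl⟩,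
        ht q (LTS.level_succ_of_rel hp hq)⟩
  · intro t
    simp only [Node.quotient, List.mem_flatMap, List.mem_map, hup]
    constructor
    · rintro ⟨_, ⟨p, hp, rfl⟩, ⟨l, y⟩, hy, rfl⟩
      obtain ⟨q, hq, rfl⟩ := (hv p hp l y).1 hy
      exact ⟨p, hp, l, q, hq, by
        rw [ht q (LTS.level_succ_of_rel hp hq), ht p (LTS.level_mono (Nat.le_succ _) hp)]⟩
    · rintro ⟨p, hp, l, q, hq, rfl⟩
      exact ⟨_, ⟨p, hp, rfl⟩, (l, q.node num), (hv p hp l _).2 ⟨q, hq, rfl⟩, by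
        rw [ht q (LTS.level_succ_of_rel hp hq), ht p (LTS.level_mono (Nat.le_succ _) hp)]⟩

end Position

end EventStructure

/-! ### Computability of the exploration -/

section

open Primrec

variable {A : Type*} [Primcodable A]

theorem Primrec.nat_pow : Primrec₂ ((· ^ ·) : ℕ → ℕ → ℕ) := Primrec₂.unpaired'.1 Nat.Primrec.pow

theorem primrec_bits : Primrec bits := by
  refine (Primrec.filter (p := fun n e => n.testBit e = true) list_range ?_).of_eq
    fun n => by simp [bits]
  refine PrimrecRel.of_eq (r := fun n e => n / 2 ^ e % 2 = 1)
    (Primrec.eq.comp (nat_mod.comp (nat_div.comp fst (nat_pow.comp (const 2) snd)) (const 2))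
      (const 1)) fun n e => ?_
  rw [Nat.testBit_eq_decide_div_mod_eq, decide_eq_true_eq]

theorem primrec_mem_bits {f g : A → ℕ} (hf : Primrec f) (hg : Primrec g) :
    PrimrecPred fun a => f a ∈ bits (g a) := PrimrecPred.mem (primrec_bits.comp hg) hf

/-- A description of `setCode` by recursion on a list, which keeps track of the elements that have
been counted. -/
theorem setCode_toFinset (l : List ℕ) :
    setCode l.toFinset = (l.foldr (fun c s => if c ∈ s.1 then s else (c :: s.1, s.2 + 2 ^ c))
      (([], 0) : List ℕ × ℕ)).2 := by
  have h : ∀ l : List ℕ, (∀ c, c ∈ (l.foldr (fun c s => if c ∈ s.1 then s else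
      (c :: s.1, s.2 + 2 ^ c)) (([], 0) : List ℕ × ℕ)).1 ↔ c ∈ l) ∧
      setCode l.toFinset = (l.foldr (fun c s => if c ∈ s.1 then s else
      (c :: s.1, s.2 + 2 ^ c)) (([], 0) : List ℕ × ℕ)).2 := by
    intro l
    induction l with
    | nil => simp [setCode]
    | cons c l ih =>
      obtain ⟨h₁, h₂⟩ := ih
      rw [List.foldr_cons]
      by_cases hc : c ∈ l
      · rw [if_pos ((h₁ c).2 hc), List.toFinset_cons, Finset.insert_eq_of_mem (by simpa using hc)]
        refine ⟨fun d => ?_, h₂⟩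
        rw [h₁, List.mem_cons]
        exact ⟨Or.inr, fun h => h.elim (fun h => h ▸ hc) id⟩
      · rw [if_neg (mt (h₁ c).1 hc), List.toFinset_cons, setCode,
          Finset.sum_insert (by simpa using hc)]
        refine ⟨fun d => by simp [h₁], ?_⟩
        rw [← h₂, add_comm]
        rfl
  exact (h l).2

theorem primrec_setCode : Primrec fun l : List ℕ => setCode l.toFinset := by
  refine Primrec.of_eq ?_ fun l => (setCode_toFinset l).symm
  refine snd.comp (list_foldr (h := fun _ y => if y.1 ∈ y.2.1 then y.2 else
    (y.1 :: y.2.1, y.2.2 + 2 ^ y.1)) Primrec.id (const (([], 0) : List ℕ × ℕ)) ?_)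
  refine ite (PrimrecPred.mem (fst.comp (snd.comp snd)) (fst.comp snd)) (snd.comp snd) ?_
  exact (list_cons.comp (fst.comp snd) (fst.comp (snd.comp snd))).pair
    (nat_add.comp (snd.comp (snd.comp snd)) (nat_pow.comp (const 2) (fst.comp snd)))

namespace Node

theorem primrec_isTraceIndex {nx : A → ℕ → ℕ} (hnx : Primrec₂ nx) {x m m' : A → ℕ}
    (hx : Primrec x) (hm : Primrec m) (hm' : Primrec m') :
    PrimrecPred fun a => IsTraceIndex (nx a) (x a) (m a) (m' a) := by
  have hnext : PrimrecPred fun y : (A × ℕ) × ℕ => y.2 ∈ bits (nx y.1.1 (x y.1.1 + 2 ^ y.1.2)) :=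
    primrec_mem_bits snd (hnx.comp (fst.comp fst)
      (nat_add.comp (hx.comp (fst.comp fst)) (nat_pow.comp (const 2) (snd.comp fst))))
  have h₁ : PrimrecPred fun a => ∀ e ∈ bits (m' a), e ∈ bits (m a) :=
    PrimrecPred.forall_mem (primrec_bits.comp hm') (primrec_mem_bits snd (hm.comp fst))
  have h₂ : PrimrecPred fun a => ∀ e ∈ bits (m' a), ∀ e' ∈ bits (m' a),
      e = e' ∨ e' ∈ bits (nx a (x a + 2 ^ e)) :=
    PrimrecPred.forall_mem (primrec_bits.comp hm') <|
      PrimrecPred.forall_mem (α := A × ℕ)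
        (p := fun y e' => y.2 = e' ∨ e' ∈ bits (nx y.1 (x y.1 + 2 ^ y.2)))
        (primrec_bits.comp (hm'.comp fst))
        (PrimrecPred.or (Primrec.eq.comp (snd.comp fst) snd) hnext)
  have h₃ : PrimrecPred fun a => ∀ e ∈ bits (m a), e ∈ bits (m' a) ∨
      ∃ e' ∈ bits (m' a), e ∉ bits (nx a (x a + 2 ^ e')) :=
    PrimrecPred.forall_mem (primrec_bits.comp hm) <|
      PrimrecPred.or (primrec_mem_bits snd (hm'.comp fst)) <|
      PrimrecPred.exists_mem (α := A × ℕ)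
        (p := fun y e' => y.2 ∉ bits (nx y.1 (x y.1 + 2 ^ e')))
        (primrec_bits.comp (hm'.comp fst))
        (hnext.comp (((fst.comp fst).pair snd).pair (snd.comp fst))).not
  exact h₁.and (h₂.and h₃)

variable {nx lb : A → ℕ → ℕ}

theorem primrec_succ (hnx : Primrec₂ nx) (hlb : Primrec₂ lb) :
    Primrec₂ fun (a : A) (p : Node) => succ (nx a) (lb a) p := by
  have hx : Primrec fun y : (A × Node) × ℕ => y.1.2.1 := fst.comp (snd.comp fst)
  have hp : Primrec fun y : (A × Node) × ℕ => y.1.2.2.1 := fst.comp (snd.comp (snd.comp fst))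
  have hm : Primrec fun y : A × Node => y.2.2.2 := snd.comp (snd.comp snd)
  have hx' : Primrec fun y : (A × Node) × ℕ => y.1.2.1 + 2 ^ y.2 :=
    nat_add.comp hx (nat_pow.comp (const 2) snd)
  have hbit : Primrec fun y : (A × Node) × ℕ => if y.2 ∈ bits y.1.2.2.1 then 1 else 0 :=
    ite (primrec_mem_bits snd hp) (const 1) (const 0)
  have hlab : Primrec fun y : (A × Node) × ℕ =>
      3 * lb y.1.1 y.2 + (if y.2 ∈ bits y.1.2.2.1 then 1 else 0) :=
    nat_add.comp (nat_mul.comp (const 3) (hlb.comp (fst.comp fst) snd)) hbit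
  have hnx₁ : Primrec fun y : (A × Node) × ℕ => nx y.1.1 y.1.2.1 := hnx.comp (fst.comp fst) hx
  have hnx₂ : Primrec fun y : (A × Node) × ℕ => nx y.1.1 (y.1.2.1 + 2 ^ y.2) :=
    hnx.comp (fst.comp fst) hx'
  have htr : PrimrecPred fun y : (A × Node) × ℕ =>
      IsTraceIndex (nx y.1.1) y.1.2.1 y.1.2.2.2 y.2 :=
    primrec_isTraceIndex (nx := fun y : (A × Node) × ℕ => nx y.1.1)
      (hnx.comp (fst.comp (fst.comp fst)) snd) hx (hm.comp fst) snd
  have h₁ : Primrec fun y : A × Node => (bits y.2.2.2).map fun e =>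
      (3 * lb y.1 e + (if e ∈ bits y.2.2.1 then 1 else 0),
        (y.2.1 + 2 ^ e, nx y.1 y.2.1, nx y.1 (y.2.1 + 2 ^ e))) :=
    list_map (primrec_bits.comp hm) (hlab.pair (hx'.pair (hnx₁.pair hnx₂))).to₂
  have h₂ : Primrec fun y : A × Node => (List.range (y.2.2.2 + 1)).filter fun m' =>
      IsTraceIndex (nx y.1) y.2.1 y.2.2.2 m' :=
    Primrec.filter (p := fun (y : A × Node) m' => IsTraceIndex (nx y.1) y.2.1 y.2.2.2 m')
      (list_range.comp (Primrec.succ.comp hm)) htr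
  have h₃ : Primrec fun y : (A × Node) × ℕ => (2, (y.1.2.1, y.1.2.2.1, y.2)) :=
    (const 2).pair (hx.pair (hp.pair snd))
  exact list_append.comp h₁ (list_map h₂ h₃.to₂)

theorem primrec_start (hnx : Primrec₂ nx) : Primrec fun a => start (nx a) :=
  (const 0).pair ((const 0).pair (hnx.comp Primrec.id (const 0)))

theorem primrec_upTo (hnx : Primrec₂ nx) (hlb : Primrec₂ lb) :
    Primrec₂ fun (a : A) (j : ℕ) => upTo (nx a) (lb a) j := by
  have h : Primrec₂ fun (a : A) (y : ℕ × List Node) =>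
      y.2 ++ y.2.flatMap fun p => (succ (nx a) (lb a) p).map Prod.snd := by
    refine list_append.comp (snd.comp snd) (list_flatMap (snd.comp snd) ?_)
    exact list_map ((primrec_succ hnx hlb).comp (fst.comp fst) snd) (snd.comp snd).to₂
  have h₀ : Primrec fun a => [start (nx a)] :=
    list_cons.comp (primrec_start hnx) (const [])
  refine (nat_rec h₀ h).of_eq fun a j => ?_
  induction j with
  | zero => rfl
  | succ j ih => simp only [ih, upTo]

theorem primrec_tau (hnx : Primrec₂ nx) (hlb : Primrec₂ lb) :
    Primrec₂ fun (a : A) (y : ℕ × Node) => tau (nx a) (lb a) y.1 y.2 := by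
  -- the values for the successors are computed together with the modalities that lead to them
  have h : Primrec₂ fun (a : A) (y : ℕ × ℕ × Node) =>
      Nat.pair y.2.1 (tau (nx a) (lb a) y.1 y.2.2) := by
    refine nat_omega_rec _ (m := fun _ y => y.1)
      (l := fun a y => if y.1 = 0 then [] else
        (succ (nx a) (lb a) y.2.2).map fun c => (y.1 - 1, c))
      (g := fun _ z => some (Nat.pair z.1.2.1
        (if z.1.1 = 0 then 0 else setCode z.2.toFinset))) ?_ ?_ ?_ ?_ ?_
    · exact fst.comp snd
    · refine ite (Primrec.eq.comp (fst.comp snd) (const 0)) (const []) ?_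
      refine list_map ((primrec_succ hnx hlb).comp fst (snd.comp (snd.comp snd))) ?_
      exact ((nat_sub.comp (fst.comp (snd.comp fst)) (const 1)).pair snd).to₂
    · refine option_some.comp (Primrec₂.natPair.comp (fst.comp (snd.comp (fst.comp snd))) ?_)
      exact ite (Primrec.eq.comp (fst.comp (fst.comp snd)) (const 0)) (const 0)
        (primrec_setCode.comp (snd.comp snd))
    · rintro a ⟨n, l, p⟩ y hy
      by_cases hn : n = 0
      · simp [hn] at hy
      · simp only [hn, if_false, List.mem_map] at hy
        obtain ⟨c, _, rfl⟩ := hy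
        exact Nat.sub_lt (Nat.pos_of_ne_zero hn) one_pos
    · rintro a ⟨n, l, p⟩
      cases n with
      | zero => simp [tau]
      | succ n => simp [tau, Function.comp_def]
  have h' : Primrec₂ fun (a : A) (y : ℕ × Node) =>
      (Nat.pair 0 (tau (nx a) (lb a) y.1 y.2)).unpair.2 :=
    snd.comp (unpair.comp (h.comp fst ((fst.comp snd).pair ((const 0).pair (snd.comp snd)))))
  exact h'.of_eq fun a y => by simp

theorem primrec_quotient (hnx : Primrec₂ nx) (hlb : Primrec₂ lb) :
    Primrec₂ fun (a : A) (j : ℕ) => quotient (nx a) (lb a) j := by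
  have hup : Primrec fun y : A × ℕ => upTo (nx y.1) (lb y.1) (y.2 + 2) :=
    (primrec_upTo hnx hlb).comp fst (nat_add.comp snd (const 2))
  have hsucc : Primrec fun y : (A × ℕ) × Node => succ (nx y.1.1) (lb y.1.1) y.2 :=
    (primrec_succ hnx hlb).comp (fst.comp fst) snd
  have htau : Primrec fun y : ((A × ℕ) × Node) × (ℕ × Node) =>
      tau (nx y.1.1.1) (lb y.1.1.1) y.1.1.2 y.2.2 :=
    (primrec_tau hnx hlb).comp (fst.comp (fst.comp fst))
      ((snd.comp (fst.comp fst)).pair (snd.comp snd))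
  have htau' : Primrec fun y : ((A × ℕ) × Node) × (ℕ × Node) =>
      tau (nx y.1.1.1) (lb y.1.1.1) y.1.1.2 y.1.2 :=
    (primrec_tau hnx hlb).comp (fst.comp (fst.comp fst))
      ((snd.comp (fst.comp fst)).pair (snd.comp fst))
  have hstart : Primrec fun y : A × ℕ => tau (nx y.1) (lb y.1) y.2 (start (nx y.1)) :=
    (primrec_tau hnx hlb).comp fst (snd.pair ((primrec_start hnx).comp fst))
  exact (list_cons.comp hstart (list_flatMap hup (list_map hsucc htau.to₂).to₂)).pair
    (list_flatMap hup (list_map hsucc (htau'.pair ((fst.comp snd).pair htau)).to₂).to₂)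

end Node

end

/-! ### The decision procedure -/

/-- The programs `(lab, next, eqv)` of a presentation. -/
abbrev Programs : Type := Code × Code × Code

namespace Programs

/-- The result of `next` on `x` after `k` steps of computation, or `0`. -/
def next (P : Programs) (k x : ℕ) : ℕ := (P.2.1.evaln k x).getD 0

/-- The result of `lab` on `x` after `k` steps of computation, or `0`. -/
def label (P : Programs) (k x : ℕ) : ℕ := (P.1.evaln k x).getD 0

/-- Within `k` steps of computation, the programs provide all the data that are needed to compute
the transitions from the node `p`. -/
def Halts (P : Programs) (k : ℕ) (p : Node) : Prop :=
  (P.2.1.evaln k p.1).isSome = true ∧ ∀ e ∈ bits p.2.2,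
    (P.2.1.evaln k (p.1 + 2 ^ e)).isSome = true ∧ (P.1.evaln k e).isSome = true

/-- `k` steps of computation suffice to see that the nodes at distance at most `j + 2` represent
all others, and that the `j`-th approximation of bisimilarity is stable on them. The types of depth `j + 1` of nodes at
distance `j + 2` depend on the transitions from the nodes at distance at most `2 * j + 2`. -/
def Exhaustive (P : Programs) (k j : ℕ) : Prop :=
  (∀ p ∈ Node.upTo (P.next k) (P.label k) (2 * j + 2), P.Halts k p) ∧
  (∀ p ∈ Node.upTo (P.next k) (P.label k) (j + 1), ∃ q ∈ Node.upTo (P.next k) (P.label k) j,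
    P.2.2.evaln k (Nat.pair p.1 q.1) = some 1) ∧
  ∀ p ∈ Node.upTo (P.next k) (P.label k) (j + 2), ∀ q ∈ Node.upTo (P.next k) (P.label k) (j + 2),
    Node.tau (P.next k) (P.label k) j p = Node.tau (P.next k) (P.label k) j q →
    Node.tau (P.next k) (P.label k) (j + 1) p = Node.tau (P.next k) (P.label k) (j + 1) q

instance (P : Programs) (k j : ℕ) : Decidable (P.Exhaustive k j) := by
  unfold Exhaustive Halts; infer_instance

section

open Primrec

variable {A : Type*} [Primcodable A]

theorem primrec_evaln {k : A → ℕ} {c : A → Code} {x : A → ℕ} (hk : Primrec k) (hc : Primrec c)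
    (hx : Primrec x) : Primrec fun a => (c a).evaln (k a) (x a) :=
  Code.primrec_evaln.comp ((hk.pair hc).pair hx)

theorem primrec_next : Primrec₂ fun (y : Programs × ℕ) x => y.1.next y.2 x :=
  option_getD.comp
    (primrec_evaln (snd.comp fst) (fst.comp (snd.comp (fst.comp fst))) snd) (const 0)

theorem primrec_label : Primrec₂ fun (y : Programs × ℕ) x => y.1.label y.2 x :=
  option_getD.comp (primrec_evaln (snd.comp fst) (fst.comp (fst.comp fst)) snd) (const 0)

theorem primrecPred_isSome {f : A → Option ℕ} (hf : Primrec f) :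
    PrimrecPred fun a => (f a).isSome = true :=
  Primrec.eq.comp (option_isSome.comp hf) (const true)

theorem primrecRel_halts : PrimrecRel fun (y : Programs × ℕ) p => y.1.Halts y.2 p := by
  refine PrimrecPred.and (primrecPred_isSome (primrec_evaln (snd.comp fst)
    (fst.comp (snd.comp (fst.comp fst))) (fst.comp snd))) ?_
  refine PrimrecPred.forall_mem (α := (Programs × ℕ) × Node)
    (primrec_bits.comp (snd.comp (snd.comp snd))) (PrimrecPred.and ?_ ?_)
  · exact primrecPred_isSome (primrec_evaln (snd.comp (fst.comp fst))
      (fst.comp (snd.comp (fst.comp (fst.comp fst))))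
      (nat_add.comp (fst.comp (snd.comp fst)) (nat_pow.comp (const 2) snd)))
  · exact primrecPred_isSome (primrec_evaln (snd.comp (fst.comp fst))
      (fst.comp (fst.comp (fst.comp fst))) snd)

theorem primrecRel_exhaustive : PrimrecRel fun (y : Programs × ℕ) j => y.1.Exhaustive y.2 j := by
  have hup : Primrec₂ fun (y : Programs × ℕ) i => Node.upTo (y.1.next y.2) (y.1.label y.2) i :=
    Node.primrec_upTo primrec_next primrec_label
  have htau : Primrec₂ fun (y : Programs × ℕ) (z : ℕ × Node) =>
      Node.tau (y.1.next y.2) (y.1.label y.2) z.1 z.2 :=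
    Node.primrec_tau primrec_next primrec_label
  have h₁ : PrimrecPred fun x : (Programs × ℕ) × ℕ =>
      ∀ p ∈ Node.upTo (x.1.1.next x.1.2) (x.1.1.label x.1.2) (2 * x.2 + 2),
        x.1.1.Halts x.1.2 p :=
    PrimrecPred.forall_mem (α := (Programs × ℕ) × ℕ) (p := fun x p => x.1.1.Halts x.1.2 p)
      (hup.comp fst (nat_add.comp (nat_mul.comp (const 2) snd) (const 2)))
      (primrecRel_halts.comp (fst.comp fst) snd)
  have h₂ : PrimrecPred fun x : (Programs × ℕ) × ℕ =>
      ∀ p ∈ Node.upTo (x.1.1.next x.1.2) (x.1.1.label x.1.2) (x.2 + 1),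
        ∃ q ∈ Node.upTo (x.1.1.next x.1.2) (x.1.1.label x.1.2) x.2,
          x.1.1.2.2.evaln x.1.2 (Nat.pair p.1 q.1) = some 1 := by
    refine PrimrecPred.forall_mem (α := (Programs × ℕ) × ℕ)
      (hup.comp fst (nat_add.comp snd (const 1))) ?_
    refine PrimrecPred.exists_mem (α := ((Programs × ℕ) × ℕ) × Node)
      (p := fun y q => y.1.1.1.2.2.evaln y.1.1.2 (Nat.pair y.2.1 q.1) = some 1)
      (hup.comp (fst.comp fst) (snd.comp fst)) ?_
    exact Primrec.eq.comp (primrec_evaln (snd.comp (fst.comp (fst.comp fst)))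
      (snd.comp (snd.comp (fst.comp (fst.comp (fst.comp fst)))))
      (Primrec₂.natPair.comp (fst.comp (snd.comp fst)) (fst.comp snd))) (const (some 1))
  have h₃ : PrimrecPred fun x : (Programs × ℕ) × ℕ =>
      ∀ p ∈ Node.upTo (x.1.1.next x.1.2) (x.1.1.label x.1.2) (x.2 + 2),
        ∀ q ∈ Node.upTo (x.1.1.next x.1.2) (x.1.1.label x.1.2) (x.2 + 2),
          Node.tau (x.1.1.next x.1.2) (x.1.1.label x.1.2) x.2 p =
            Node.tau (x.1.1.next x.1.2) (x.1.1.label x.1.2) x.2 q →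
          Node.tau (x.1.1.next x.1.2) (x.1.1.label x.1.2) (x.2 + 1) p =
            Node.tau (x.1.1.next x.1.2) (x.1.1.label x.1.2) (x.2 + 1) q := by
    have hj : Primrec fun y : (((Programs × ℕ) × ℕ) × Node) × Node => y.1.1.2 :=
      snd.comp (fst.comp fst)
    have hj' : Primrec fun y : (((Programs × ℕ) × ℕ) × Node) × Node => y.1.1.2 + 1 :=
      nat_add.comp hj (const 1)
    have hy : Primrec fun y : (((Programs × ℕ) × ℕ) × Node) × Node => y.1.1.1 :=
      fst.comp (fst.comp fst)
    refine PrimrecPred.forall_mem (α := (Programs × ℕ) × ℕ)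
      (hup.comp fst (nat_add.comp snd (const 2))) ?_
    refine PrimrecPred.forall_mem (α := ((Programs × ℕ) × ℕ) × Node)
      (p := fun y q => Node.tau (y.1.1.1.next y.1.1.2) (y.1.1.1.label y.1.1.2) y.1.2 y.2 =
            Node.tau (y.1.1.1.next y.1.1.2) (y.1.1.1.label y.1.1.2) y.1.2 q →
          Node.tau (y.1.1.1.next y.1.1.2) (y.1.1.1.label y.1.1.2) (y.1.2 + 1) y.2 =
            Node.tau (y.1.1.1.next y.1.1.2) (y.1.1.1.label y.1.1.2) (y.1.2 + 1) q)
      (hup.comp (fst.comp fst) (nat_add.comp (snd.comp fst) (const 2))) ?_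
    refine PrimrecPred.of_eq (PrimrecPred.or
      (PrimrecPred.not (Primrec.eq.comp (htau.comp hy (hj.pair (snd.comp fst)))
        (htau.comp hy (hj.pair snd))))
      (Primrec.eq.comp (htau.comp hy (hj'.pair (snd.comp fst)))
        (htau.comp hy (hj'.pair snd)))) fun y => ?_
    exact imp_iff_not_or.symm
  exact h₁.and (h₂.and h₃)

end

end Programs

namespace EventStructure

open Position

variable {α : Type u} {E : EventStructure α ℕ} {sim : Setoid E.Config} {num : α → ℕ}
  {P : Programs}

theorem IsPresentedBy.imageFinite (h : E.IsPresentedBy sim num P.1 P.2.1 P.2.2) :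
    E.ImageFinite := by
  intro C
  obtain ⟨F, hF, _⟩ := h.next_spec C
  exact F.finite_toSet.subset fun e he => Finset.mem_coe.2 ((hF e).2 he)

theorem IsPresentedBy.eval_next (h : E.IsPresentedBy sim num P.1 P.2.1 P.2.2)
    (hfin : E.ImageFinite) (C : E.Config) :
    P.2.1.eval (canonicalIndex num C.events) =
      Part.some (canonicalIndex num (enabledSet hfin C)) := by
  obtain ⟨F, hF, h'⟩ := h.next_spec C
  rw [h']
  congr
  ext e
  rw [hF, mem_enabledSet]

theorem getD_evaln {c : Code} {k x y : ℕ} (h : c.eval x = Part.some y)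
    (hk : (c.evaln k x).isSome = true) : (c.evaln k x).getD 0 = y := by
  obtain ⟨z, hz⟩ := Option.isSome_iff_exists.1 hk
  have := Code.evaln_sound (Option.mem_def.2 hz)
  rw [h, Part.mem_some_iff] at this
  rw [hz, this]
  rfl

theorem eventually_evaln {c : Code} {x y : ℕ} (h : c.eval x = Part.some y) :
    ∀ᶠ k in Filter.atTop, c.evaln k x = some y := by
  obtain ⟨k₀, hk₀⟩ := Code.evaln_complete.1 (h ▸ Part.mem_some y)
  exact Filter.eventually_atTop.2 ⟨k₀, fun k hk => Option.mem_def.1 (Code.evaln_mono hk hk₀)⟩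

variable {hfin : E.ImageFinite}

theorem IsPresentedBy.correct_of_halts (h : E.IsPresentedBy sim num P.1 P.2.1 P.2.2) {k : ℕ}
    {p : E.Position} (hp : P.Halts k (p.node num)) :
    Correct hfin num (P.next k) (P.label k) p := by
  refine ⟨getD_evaln (h.eval_next hfin _) hp.1, fun e he => ?_⟩
  obtain ⟨h₁, h₂⟩ := hp.2 _ ((num_mem_bits h.num_injective).2 he)
  refine ⟨getD_evaln (h.lab_spec e) h₂, fun C' hC' => ?_⟩
  refine getD_evaln (h.eval_next hfin _) ?_
  rw [hC'.canonicalIndex_eq]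
  exact h₁

theorem IsPresentedBy.eventually_halts (h : E.IsPresentedBy sim num P.1 P.2.1 P.2.2)
    (hfin : E.ImageFinite) {p : E.Position} (hp : p.Valid) :
    ∀ᶠ k in Filter.atTop, P.Halts k (p.node num) := by
  have h₁ : ∀ᶠ k in Filter.atTop, ∀ e ∈ p.supp,
      (P.2.1.evaln k (canonicalIndex num p.config.events + 2 ^ num e)).isSome = true ∧
      (P.1.evaln k (num e)).isSome = true := by
    refine (Filter.eventually_all_finset p.supp).2 fun e he => ?_
    obtain ⟨C', hC'⟩ := hp e he
    filter_upwards [eventually_evaln (h.eval_next hfin C'), eventually_evaln (h.lab_spec e)]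
      with k hk hk'
    rw [← hC'.canonicalIndex_eq, hk, hk']
    exact ⟨rfl, rfl⟩
  filter_upwards [h₁, eventually_evaln (h.eval_next hfin p.config)] with k hk hk'
  refine ⟨?_, (forall_mem_bits h.num_injective).2 hk⟩
  simp only [node, hk']
  rfl

/-- If the programs halt at all nodes that they lead to, then they compute correct transitions. -/
theorem IsPresentedBy.correct_of_forall_halts (h : E.IsPresentedBy sim num P.1 P.2.1 P.2.2)
    {k J : ℕ} (hh : ∀ p ∈ Node.upTo (P.next k) (P.label k) J, P.Halts k p) :
    ∀ p ∈ level hfin J, Correct hfin num (P.next k) (P.label k) p := by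
  have hmono : Monotone fun i => {p | p ∈ Node.upTo (P.next k) (P.label k) i} :=
    monotone_nat_of_le_succ fun i p hp => List.mem_append.2 (Or.inl hp)
  suffices ∀ i, i ≤ J → ∀ p ∈ level hfin i, Correct hfin num (P.next k) (P.label k) p from
    this J le_rfl
  intro i
  induction i with
  | zero =>
    rintro hi p rfl
    have hs : Node.start (P.next k) ∈ Node.upTo (P.next k) (P.label k) J :=
      hmono (Nat.zero_le J) (List.mem_singleton.2 rfl)
    have h₀ : P.next k 0 = canonicalIndex num (enabledSet hfin (Config.empty E)) :=
      getD_evaln (h.eval_next hfin (Config.empty E)) (hh _ hs).1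
    refine h.correct_of_halts ?_
    convert hh _ hs using 1
    rw [Node.start, h₀]
    rfl
  | succ i ih =>
    intro hi p hp
    refine h.correct_of_halts (hh _ (hmono hi ?_))
    exact (mem_upTo_iff h.num_injective (ih (by omega)) (i + 1) le_rfl _).2 ⟨p, hp, rfl⟩

theorem IsPresentedBy.stable_iff (h : E.IsPresentedBy sim num P.1 P.2.1 P.2.2) {k j : ℕ}
    (hc : ∀ p ∈ level hfin (2 * j + 2), Correct hfin num (P.next k) (P.label k) p) :
    (∀ p ∈ Node.upTo (P.next k) (P.label k) (j + 2),
      ∀ q ∈ Node.upTo (P.next k) (P.label k) (j + 2),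
        Node.tau (P.next k) (P.label k) j p = Node.tau (P.next k) (P.label k) j q →
        Node.tau (P.next k) (P.label k) (j + 1) p = Node.tau (P.next k) (P.label k) (j + 1) q) ↔
      LTS.Stable (Rel hfin) (level hfin (j + 2)) j := by
  have hup := mem_upTo_iff h.num_injective hc (j + 2) (by omega)
  have ht := tau_eq_typ h.num_injective hc j (j + 2) (by omega)
  have ht' := tau_eq_typ h.num_injective hc (j + 1) (j + 2) (by omega)
  constructor
  · intro hs p hp q hq
    rw [← ht p hp, ← ht q hq, ← ht' p hp, ← ht' q hq]
    exact hs _ ((hup _).2 ⟨p, hp, rfl⟩) _ ((hup _).2 ⟨q, hq, rfl⟩)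
  · intro hs y hy z hz
    obtain ⟨p, hp, rfl⟩ := (hup y).1 hy
    obtain ⟨q, hq, rfl⟩ := (hup z).1 hz
    rw [ht p hp, ht q hq, ht' p hp, ht' q hq]
    exact hs p hp q hq

/-- The search for an exhaustive exploration succeeds. -/
theorem IsPresentedBy.exists_exhaustive (h : E.IsPresentedBy sim num P.1 P.2.1 P.2.2)
    (hsim : E.IsRegularQuotient sim) : ∃ k j, P.Exhaustive k j := by
  have hfin := h.imageFinite
  obtain ⟨j, hcov, hst⟩ := Position.exists_exhaustive (hfin := hfin) hsim
  have hlev : ∀ i, (level hfin i).Finite := fun i => LTS.level_finite finBranching i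
  have h₁ : ∀ᶠ k in Filter.atTop, ∀ p ∈ level hfin (2 * j + 2), P.Halts k (p.node num) :=
    (Filter.eventually_all_finite (hlev _)).2
      fun p hp => h.eventually_halts hfin (valid_of_mem_level hp)
  have h₂ : ∀ᶠ k in Filter.atTop, ∀ p ∈ level hfin (j + 1), ∃ q ∈ level hfin j,
      P.2.2.evaln k (Nat.pair (p.node num).1 (q.node num).1) = some 1 := by
    refine (Filter.eventually_all_finite (hlev _)).2 fun p hp => ?_
    obtain ⟨q, hq, hpq⟩ := hcov p hp
    filter_upwards [eventually_evaln (h.eqv_true _ _ hpq)] with k hk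
    exact ⟨q, hq, hk⟩
  obtain ⟨k, hk₁, hk₂⟩ := (h₁.and h₂).exists
  have hc : ∀ p ∈ level hfin (2 * j + 2), Correct hfin num (P.next k) (P.label k) p :=
    fun p hp => h.correct_of_halts (hk₁ p hp)
  have hup := mem_upTo_iff h.num_injective hc
  refine ⟨k, j, fun y hy => ?_, fun y hy => ?_, (h.stable_iff hc).2 hst⟩
  · obtain ⟨p, hp, rfl⟩ := (hup _ (by omega) y).1 hy
    exact hk₁ p hp
  · obtain ⟨p, hp, rfl⟩ := (hup _ (by omega) y).1 hy
    obtain ⟨q, hq, hpq⟩ := hk₂ p hp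
    exact ⟨_, (hup j (by omega) _).2 ⟨q, hq, rfl⟩, hpq⟩

/-- An exhaustive exploration yields a finite system with the same specifications. -/
theorem IsPresentedBy.mem_denote_iff (h : E.IsPresentedBy sim num P.1 P.2.1 P.2.2)
    (hsim : E.IsRegularQuotient sim) {k j : ℕ} (hex : P.Exhaustive k j) :
    (∀ t ∈ (Node.quotient (P.next k) (P.label k) j).2,
      t.2.2 ∈ (Node.quotient (P.next k) (P.label k) j).1) ∧
    ∃ x : (Node.quotient (P.next k) (P.label k) j).Point,
      x.1 = Node.tau (P.next k) (P.label k) j (Node.start (P.next k)) ∧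
      ∀ φ : TFL ℕ, φ.IsSpec → ∀ V W,
        E.toSystem.initProc ∈ E.toSystem.denote φ V ↔
          x ∈ TFL.den (Node.quotient (P.next k) (P.label k) j).Rel φ W := by
  have hfin := h.imageFinite
  obtain ⟨hhalt, hcov, hst⟩ := hex
  have hc : ∀ p ∈ level hfin (2 * j + 2), Correct hfin num (P.next k) (P.label k) p :=
    h.correct_of_forall_halts hhalt
  have hup := mem_upTo_iff h.num_injective hc
  have hK := isQuotientSystem_quotient h.num_injective hc
  have hi : initial hfin ∈ level hfin 0 := rfl
  refine ⟨hK.target_mem, ⟨LTS.typ (Rel hfin) j (initial hfin), (hK.1 _).2 (Or.inl rfl)⟩, ?_,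
    fun φ hφ V W => hK.initProc_mem_denote_iff (fun p hp => ?_) ((h.stable_iff hc).1 hst) hφ V W⟩
  · rw [← node_initial (hc _ (LTS.level_mono (Nat.zero_le _) hi)),
      tau_eq_typ h.num_injective hc j 0 (by omega) _ hi]
  · obtain ⟨y, hy, hev⟩ := hcov _ ((hup (j + 1) (by omega) _).2 ⟨p, hp, rfl⟩)
    obtain ⟨q, hq, rfl⟩ := (hup j (by omega) y).1 hy
    refine ⟨q, hq, hsim.futureIso _ _ ?_⟩
    by_contra hns
    have := Code.evaln_sound (Option.mem_def.2 hev)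
    rw [node, node, h.eqv_false _ _ hns, Part.mem_some_iff] at this
    exact one_ne_zero this

end EventStructure

/-- The finite system that is obtained by the exploration with number `i`, and its initial point. An
exploration is given by a number of computation steps and a depth. -/
def Programs.quotient (P : Programs) (i : ℕ) : FinSys × ℕ :=
  (Node.quotient (P.next i.unpair.1) (P.label i.unpair.1) i.unpair.2,
    Node.tau (P.next i.unpair.1) (P.label i.unpair.1) i.unpair.2
      (Node.start (P.next i.unpair.1)))

theorem Programs.primrec_quotient : Primrec₂ Programs.quotient := by
  have hi : Primrec fun y : Programs × ℕ => y.2.unpair := Primrec.unpair.comp Primrec.snd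
  have hy : Primrec fun y : Programs × ℕ => (y.1, y.2.unpair.1) :=
    Primrec.fst.pair (Primrec.fst.comp hi)
  have hj : Primrec fun y : Programs × ℕ => y.2.unpair.2 := Primrec.snd.comp hi
  have hK : Primrec fun y : Programs × ℕ =>
      Node.quotient (y.1.next y.2.unpair.1) (y.1.label y.2.unpair.1) y.2.unpair.2 :=
    (Node.primrec_quotient primrec_next primrec_label).comp hy hj
  have hstart : Primrec fun y : Programs × ℕ => Node.start (y.1.next y.2.unpair.1) :=
    (Node.primrec_start primrec_next).comp hy
  have hs : Primrec fun y : Programs × ℕ =>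
      Node.tau (y.1.next y.2.unpair.1) (y.1.label y.2.unpair.1) y.2.unpair.2
        (Node.start (y.1.next y.2.unpair.1)) :=
    (Node.primrec_tau primrec_next primrec_label).comp hy (hj.pair hstart)
  exact hK.pair hs

theorem Programs.primrec_exhaustive :
    Primrec₂ fun (P : Programs) (i : ℕ) => decide (P.Exhaustive i.unpair.1 i.unpair.2) := by
  have hi : Primrec fun y : Programs × ℕ => y.2.unpair := Primrec.unpair.comp Primrec.snd
  have hy : Primrec fun y : Programs × ℕ => (y.1, y.2.unpair.1) :=
    Primrec.fst.pair (Primrec.fst.comp hi)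
  have hj : Primrec fun y : Programs × ℕ => y.2.unpair.2 := Primrec.snd.comp hi
  exact (primrecRel_exhaustive.comp hy hj).decide

/-- One algorithm for all presentations: search for an exhaustive exploration, and run the model
checker on the finite quotient that it yields. -/
theorem EventStructure.exists_partrec_decision :
    ∃ D : Programs × ℕ →. Bool, Partrec D ∧
      ∀ (α : Type u) (E : EventStructure α ℕ) (sim : Setoid E.Config) (num : α → ℕ)
        (P : Programs), E.IsRegularQuotient sim → E.IsPresentedBy sim num P.1 P.2.1 P.2.2 →
        ∀ φ : TFL ℕ, φ.IsSpec →
          (D (P, φ.code)).Dom ∧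
          ∀ V : ℕ → Set E.toSystem.Proc,
            true ∈ D (P, φ.code) ↔ E.toSystem.initProc ∈ E.toSystem.denote φ V := by
  obtain ⟨mc, hmc, hspec⟩ := FinSys.exists_modelChecker
  let answer : Programs × ℕ → ℕ → Bool := fun x i =>
    mc ((x.1.quotient i).1, (x.1.quotient i).2, x.2)
  let D : Programs × ℕ →. Bool := fun x =>
    (Nat.rfind fun i => Part.some (decide (x.1.Exhaustive i.unpair.1 i.unpair.2))).map (answer x)
  refine ⟨D, ?_, ?_⟩
  · have hsearch : Computable₂ fun (x : Programs × ℕ) (i : ℕ) =>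
        decide (x.1.Exhaustive i.unpair.1 i.unpair.2) :=
      Programs.primrec_exhaustive.to_comp.comp (Computable.fst.comp Computable.fst) Computable.snd
    have hK : Computable fun y : (Programs × ℕ) × ℕ => y.1.1.quotient y.2 :=
      Programs.primrec_quotient.to_comp.comp (Computable.fst.comp Computable.fst) Computable.snd
    have hans : Computable₂ answer :=
      hmc.comp ((Computable.fst.comp hK).pair
        ((Computable.snd.comp hK).pair (Computable.snd.comp Computable.fst)))
    exact (Partrec.rfind hsearch.partrec₂).map hans
  · intro α E sim num P hsim hP φ hφ
    obtain ⟨k, j, hkj⟩ := hP.exists_exhaustive hsim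
    obtain ⟨i, hi, _⟩ := Nat.rfind_min'
      (p := fun i => decide (P.Exhaustive i.unpair.1 i.unpair.2)) (m := Nat.pair k j)
      (by simpa using hkj)
    have hex : P.Exhaustive i.unpair.1 i.unpair.2 := by simpa using Nat.rfind_spec hi
    have hD : D (P, φ.code) = Part.some (answer (P, φ.code) i) := by
      exact Part.eq_some_iff.2 (Part.mem_map _ hi)
    rw [hD]
    refine ⟨trivial, fun V => ?_⟩
    obtain ⟨htgt, x, hx, hsat⟩ := hP.mem_denote_iff hsim hex
    obtain ⟨W, hW⟩ := hspec _ x htgt φ hφ.1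
    rw [hsat φ hφ V W, ← hW, hx, Part.mem_some_iff]
    exact eq_comm

theorem mainTheorem9 :
    -- one algorithm for all regular event structures presented as regular quotient sets
    (∃ D : (Code × Code × Code) × ℕ →. Bool, Partrec D ∧
      ∀ (α : Type u) (E : EventStructure α ℕ) (sim : Setoid E.Config) (num : α → ℕ)
        (lab next eqv : Code),
        E.IsRegularQuotient sim → E.IsPresentedBy sim num lab next eqv →
        ∀ φ : TFL ℕ, φ.IsSpec →
          (D ((lab, next, eqv), φ.code)).Dom ∧
          ∀ V : ℕ → Set E.toSystem.Proc,
            true ∈ D ((lab, next, eqv), φ.code) ↔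
              E.toSystem.initProc ∈ E.toSystem.denote φ V) ∧
    -- every regular event structure, however it is given, has a decidable theory
    (∀ (α : Type u) (E : EventStructure α ℕ), E.IsRegular →
      ∃ d : ℕ → Bool, Computable d ∧
        ∀ φ : TFL ℕ, φ.IsSpec → ∀ V : ℕ → Set E.toSystem.Proc,
          d φ.code = true ↔ E.toSystem.initProc ∈ E.toSystem.denote φ V) := by
  refine ⟨?_, fun α E hE => hE.exists_computable⟩
  obtain ⟨D, hD, hspec⟩ := EventStructure.exists_partrec_decision
  exact ⟨D, hD, fun α E sim num lab next eqv hsim hP => hspec α E sim num (lab, next, eqv) hsim hP⟩
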